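/- Let $1\le k\le\infty$, and let $M$ be a connected, Hausdorff manifold of class $C^k$ (without boundary, modeled on some $\mathbb{R}^n$, not necessarily second-countable) of dimension $n\ge 2$. *Submanifolds.* Put $H_0:=\mathbb{R}^0$ and $H_d:=\{x\in\mathbb{R}^d : x_d\ge 0\}$ for $d\ge 1$. A subset $S\subset M$ is a *$C^1$ submanifold with boundary* of $M$ if for every $p\in S$ there are $d,c\in\mathbb{N}$, an open neighborhood $U$ of $p$ in $M$, an open set $V\subset\mathbb{R}^d\times\mathbb{R}^c$ and a $C^1$ diffeomorphism $\phi\colon U\to V$ with $\phi(S\cap U)=(H_d\times\{0\})\cap V$; one then writes $\operatorname{codim}_p(S,M)=c$, and $\operatorname{codim}(S,M):=\inf_{p\in S}\operatorname{codim}_p(S,M)$, with $\inf\emptyset=\infty$. For a topological space $X$, $\partial X$ denotes the set of points $p\in X$ that have an open neighborhood $U'$ in $X$ with a homeomorphism $U'\to H_d$, for some $d$, taking $p$ into the topological boundary of $H_d$ in $\mathbb{R}^d$. A $C^1$ submanifold (without boundary) is a $C^1$ submanifold with boundary $S$ such that $\partial S=\emptyset$. *Negligible sets.* Vector bundles $E$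 over $M$ are real, of finite rank and of some class $C^l$, $0\le l\le k$. For $l\ge 1$, a connection $\nabla$ on $E$ is a linear connection (covariant derivative), taking $C^1$ sections of $E$ over open sets $U\subset M$ to continuous sections of $T^\vee M\otimes E$ over $U$; it is of class $C^m$ if $m+1\le l$ and $\nabla$ takes $C^l$ sections to $C^m$ sections (with $\infty+1=\infty$ and $\infty-1=\infty$). A $\nabla$-parallel section over $U$ is a $C^1$ section $s$ of $E$ over $U$ with $\nabla s=0$. A closed set $F\subset M$ is *negligible in $M$ for $(E,\nabla)$* if every $\nabla$-parallel section over $M\setminus F$ is the restriction of a $\nabla$-parallel section over $M$; it is *negligible in $M$ for all connections of class $C^m$* if this holds for all vector bundles $E$ over $M$ and all connections $\nabla$ of class $C^m$ on $E$. Assume that $M$ is *dissected by $C^1$ hypersurfaces*, that is, for every closed, connected $C^1$ submanifold (without boundary) $S$ of $M$ with $\operatorname{codim}(S,M)=1$, the space $M\setminus S$ is disconnected (the disjoint union of two nonempty open subsets). Let $F\ne M$ be a closed $C^1$ submanifold with boundary of $M$. Then the following are equivalent: 1. $F$ is negligible in $M$ for all connections of class $C^0$. 2. $F$ is negligible in $M$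 for all connections of class $C^{k-1}$. 3. $F$ is negligible in $M$ for $(E,\nabla)$, for every connection $\nabla$ of class $C^{k-1}$ on the trivial bundle $E=M\times\mathbb{R}$ of rank $1$ over $M$ (a bundle of class $C^k$). 4. $F$ is nowhere dense in $M$ and $M\setminus F$ is connected. 5. $\operatorname{codim}(F,M)\ge 1$, and there is no connected component $Z$ of $F$ such that $\operatorname{codim}(Z,M)=1$ and $\partial Z=\emptyset$. -/

import Mathlib

open Set Bundle TopologicalSpace
open scoped Manifold ContDiff Topology

universe u v

noncomputable section

namespace ParallelExt

/-! ### Submanifolds with boundary -/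

/-- The closed half-space of `ℝ^d` on which the last coordinate is nonnegative; all of `ℝ^0` when
`d = 0`. -/
def halfSpace : (d : ℕ) → Set (EuclideanSpace ℝ (Fin d))
  | 0 => univ
  | d + 1 => {x | 0 ≤ x (Fin.last d)}

/-- The boundary `∂X` (in the manifold sense) of a topological space `X`: the points that have an
open neighbourhood homeomorphic to some half-space of `ℝ^d`, by a homeomorphism that takes the
point into the topological boundary of the half-space in `ℝ^d`. -/
def boundaryPoints (X : Type*) [TopologicalSpace X] : Set X :=
  {p | ∃ (d : ℕ) (U : Opens X) (hp : p ∈ U) (φ : U ≃ₜ halfSpace d),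
    (φ ⟨p, hp⟩ : EuclideanSpace ℝ (Fin d)) ∈ frontier (halfSpace d)}

section Submanifold

variable (n : ℕ) {M : Type u} [TopologicalSpace M] [ChartedSpace (EuclideanSpace ℝ (Fin n)) M]

/-- At its point `p`, the set `S` is a `C^m` submanifold with boundary of `M`, of codimension `c`:
some `C^m` diffeomorphism `φ` from an open neighbourhood of `p` in `M` onto an open subset of
`ℝ^d × ℝ^c` takes `S` to the half-space slice `H_d × {0}`. -/
def HasCodimAt (m : ℕ∞) (S : Set M) (p : M) (c : ℕ) : Prop :=
  ∃ (d : ℕ) (φ : OpenPartialHomeomorph M (EuclideanSpace ℝ (Fin d) × EuclideanSpace ℝ (Fin c))),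
    p ∈ φ.source ∧
    ContMDiffOn (𝓡 n) 𝓘(ℝ, EuclideanSpace ℝ (Fin d) × EuclideanSpace ℝ (Fin c)) m φ φ.source ∧
    ContMDiffOn 𝓘(ℝ, EuclideanSpace ℝ (Fin d) × EuclideanSpace ℝ (Fin c)) (𝓡 n) m
      φ.symm φ.target ∧
    φ '' (S ∩ φ.source) = (halfSpace d ×ˢ {0}) ∩ φ.target

/-- `S` is a `C^m` submanifold with boundary of `M`. -/
def IsSubmanifoldWithBoundary (m : ℕ∞) (S : Set M) : Prop :=
  ∀ p ∈ S, ∃ c : ℕ, HasCodimAt n m S p c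

/-- The codimension of the `C^m` submanifold with boundary `S` of `M`: the infimum of the
codimensions at the points of `S` (which is `∞` when `S` is empty). -/
def codim (m : ℕ∞) (S : Set M) : ℕ∞ :=
  ⨅ (p : M) (_ : p ∈ S) (c : ℕ) (_ : HasCodimAt n m S p c), (c : ℕ∞)

variable (M) in
/-- `M` is dissected by `C^1` hypersurfaces: the complement of every closed, connected `C^1`
submanifold (without boundary) of codimension `1` is disconnected. -/
def DissectedByHypersurfaces : Prop :=
  ∀ S : Set M, IsClosed S → IsConnected S → IsSubmanifoldWithBoundary n 1 S →
    boundaryPoints S = ∅ → codim n 1 S = 1 → ¬ IsPreconnected Sᶜ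

end Submanifold

/-! ### Connections, parallel sections, negligible sets -/

section Connection

variable {n : ℕ} {M : Type u} [TopologicalSpace M] [ChartedSpace (EuclideanSpace ℝ (Fin n)) M]
  [IsManifold (𝓡 n) 1 M]
  {V : Type v} [NormedAddCommGroup V] [NormedSpace ℝ V]
  {E : M → Type v} [TopologicalSpace (TotalSpace V E)]
  [∀ x, AddCommGroup (E x)] [∀ x, Module ℝ (E x)] [∀ x, TopologicalSpace (E x)]
  [∀ x, IsTopologicalAddGroup (E x)] [∀ x, ContinuousSMul ℝ (E x)]
  [FiberBundle V E] [VectorBundle ℝ V E]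

/-- `∇` maps `C^a` sections of `E` over any open subset of `M` to `C^b` sections of
`T^∨ M ⊗ E = Hom(TM, E)`. -/
def MapsSections (a b : ℕ∞) (cov : CovariantDerivative (𝓡 n) V E) : Prop :=
  ∀ (U : Set M) (σ : (x : M) → E x), IsOpen U →
    ContMDiffOn (𝓡 n) ((𝓡 n).prod 𝓘(ℝ, V)) a (fun x ↦ TotalSpace.mk' V x (σ x)) U →
    ContMDiffOn (𝓡 n) ((𝓡 n).prod 𝓘(ℝ, EuclideanSpace ℝ (Fin n) →L[ℝ] V)) b
      (fun x ↦ TotalSpace.mk' (EuclideanSpace ℝ (Fin n) →L[ℝ] V)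
        (E := fun x ↦ TangentSpace (𝓡 n) x →L[ℝ] E x) x (cov σ x)) U

/-- `∇` is a connection of class `C^m` on the `C^l` vector bundle `E`: it takes `C^1` sections to
continuous ones; moreover `m + 1 ≤ l`, and it takes `C^l` sections to `C^m` ones. -/
def IsConnectionOfClass (l m : ℕ∞) (cov : CovariantDerivative (𝓡 n) V E) : Prop :=
  MapsSections 1 0 cov ∧ m + 1 ≤ l ∧ MapsSections l m cov

/-- `σ` represents a `∇`-parallel section over the open set `U`: it is `C^1` on `U` with
`∇ σ = 0` there. The values of `σ` off `U` play no role. -/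
def IsParallelOn (cov : CovariantDerivative (𝓡 n) V E) (σ : (x : M) → E x) (U : Set M) : Prop :=
  ContMDiffOn (𝓡 n) ((𝓡 n).prod 𝓘(ℝ, V)) 1 (fun x ↦ TotalSpace.mk' V x (σ x)) U ∧
    ∀ x ∈ U, cov σ x = 0

/-- `F` is negligible in `M` for `(E, ∇)`: every parallel section over `M \ F` is the restriction
of a parallel section over `M`. -/
def NegligibleFor (F : Set M) (cov : CovariantDerivative (𝓡 n) V E) : Prop :=
  ∀ σ : (x : M) → E x, IsParallelOn cov σ Fᶜ →
    ∃ τ : (x : M) → E x, IsParallelOn cov τ univ ∧ ∀ x ∈ Fᶜ, τ x = σ x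

end Connection

section Negligible

variable (n : ℕ) {M : Type u} [TopologicalSpace M] [ChartedSpace (EuclideanSpace ℝ (Fin n)) M]
  [IsManifold (𝓡 n) 1 M]

/-- `F` is negligible in the `C^k` manifold `M` for all connections of class `C^m`: for all
finite-rank vector bundles `E` of some class `C^l`, `l ≤ k`, over `M` and all connections of class
`C^m` on `E`. -/
def NegligibleForAll (k m : ℕ∞) (F : Set M) : Prop :=
  ∀ (l : ℕ∞), l ≤ k →
  ∀ (V : Type v) [NormedAddCommGroup V] [NormedSpace ℝ V] [FiniteDimensional ℝ V]
    (E : M → Type v) [TopologicalSpace (TotalSpace V E)]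
    [∀ x, AddCommGroup (E x)] [∀ x, Module ℝ (E x)] [∀ x, TopologicalSpace (E x)]
    [∀ x, IsTopologicalAddGroup (E x)] [∀ x, ContinuousSMul ℝ (E x)]
    [FiberBundle V E] [VectorBundle ℝ V E] [ContMDiffVectorBundle l V E (𝓡 n)]
    (cov : CovariantDerivative (𝓡 n) V E),
    IsConnectionOfClass l m cov → NegligibleFor F cov

/-- `F` is negligible in the `C^k` manifold `M` for all connections of class `C^m` on the trivial
line bundle `M × ℝ`, which is of class `C^k`. -/
def NegligibleForTrivialLine (k m : ℕ∞) (F : Set M) : Prop :=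
  ∀ cov : CovariantDerivative (𝓡 n) ℝ (Bundle.Trivial M ℝ),
    IsConnectionOfClass k m cov → NegligibleFor F cov

end Negligible

end ParallelExt

end

/-!
The implications between negligibility for all connections of class `C^0`, for all of class
`C^(k-1)`, and the geometric conditions on `F` form a loop, with the trivial line bundle on a side
branch; each arrow has a separate reason.

*Negligible implies nowhere dense with connected complement.* Both properties are detected on a
trivial bundle. If `Fᶜ` is the disjoint union of two open sets, a section that is constant on one
and zero on the other is parallel for the trivial connection, but a parallel section on the
connected manifold `M` that vanishes somewhere vanishes everywhere
(`IsParallelOn.eq_zero_of_eq_zero`). If `F` has an interior point, the connection `d + a db`, with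
`a` and `b` functions supported in `F` that are two coordinates near the point, is trivial off `F`
but has curvature `da ∧ db ≠ 0` inside; a constant section off `F` is then parallel, while its
extension would have to vanish at the point (`eq_zero_of_hasFDerivAt_neg_smul`). This uses `2 ≤ n`.

*The complement of `F` connected implies that `F` has no closed components of codimension one
without boundary.* Such a component `Z` is a closed connected hypersurface, so `Zᶜ` is disconnected
by hypothesis, but `Fᶜ ⊆ Zᶜ` is dense and connected.

*The codimension condition implies negligibility.* In a slice chart of positive codimension, `F`
lies in a hyperplane. Parallel sections solve a linear equation `Dg = B g` there
(`exists_coordinate_form`), so on each side of the hyperplane they extend to it by Grönwall's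
inequality, and on the hyperplane both extensions solve the same linear equation, hence agree
as soon as they agree at one point (`exists_extension_across_hyperplane`). So local extendability
spreads along the connected components of `F` (`extendsNear_of_isPreconnected`), and one point
in each component suffices. The points where `F` has codimension at least two, and the boundary
points of `F`, are such, because the hyperplane has points off `F` nearby
(`IsSliceChart.extendsNear`). For a component of codimension one, the hypothesis provides a point of
`boundaryPoints Z`, which is intrinsic to the space `Z`; that it is on the boundary of the
half-space in a slice chart as well is the invariance of the boundary
(`notMem_boundaryPoints_of_slice`). This follows from the no-retraction theorem
(`exists_eq_zero_of_eq_id_on_sphere`), which is proved by integrating a Jacobian determinant.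
-/


/-! ### The no-retraction theorem -/

namespace ParallelExt

section NoRetraction

open MeasureTheory Metric
open scoped NNReal

/-- `t ↦ det (1 + t A)` is a polynomial function of degree at most `dim E`. -/
theorem exists_polynomial_eval_eq_det_one_add_smul {E : Type*} [NormedAddCommGroup E]
    [NormedSpace ℝ E] [FiniteDimensional ℝ E] (A : E →L[ℝ] E) :
    ∃ p : Polynomial ℝ, p.natDegree ≤ Module.finrank ℝ E ∧
      ∀ t : ℝ, p.eval t = (ContinuousLinearMap.id ℝ E + t • A).det := by
  let b := Module.finBasis ℝ E
  let N : Matrix (Fin (Module.finrank ℝ E)) (Fin (Module.finrank ℝ E)) ℝ :=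
    LinearMap.toMatrix b b A.toLinearMap
  refine ⟨((Polynomial.X : Polynomial ℝ) • N.map Polynomial.C +
    (1 : Matrix _ _ ℝ).map Polynomial.C).det, ?_, fun t ↦ ?_⟩
  · simpa using Polynomial.natDegree_det_X_add_C_le N 1
  · have h1 : (ContinuousLinearMap.id ℝ E + t • A).det
        = LinearMap.det (LinearMap.id + t • A.toLinearMap) := rfl
    rw [h1, ← LinearMap.det_toMatrix b, map_add, map_smul, LinearMap.toMatrix_id,
      ← Polynomial.coe_evalRingHom, RingHom.map_det]
    congr 1
    ext i j
    simp [N, Matrix.one_apply, add_comm]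
    split_ifs <;> simp [mul_comm]

/-- Gluing a Lipschitz function on a closed ball that vanishes on the sphere with zero. -/
theorem lipschitzWith_indicator_closedBall {E F : Type*} [NormedAddCommGroup E] [NormedSpace ℝ E]
    [NormedAddCommGroup F] {R : ℝ} {w : E → F} {K : ℝ≥0}
    (hw : LipschitzOnWith K w (closedBall 0 R)) (h0 : ∀ x ∈ sphere (0 : E) R, w x = 0) :
    LipschitzWith K ((closedBall (0 : E) R).indicator w) := by
  have key : ∀ x ∈ closedBall (0 : E) R, ∀ y ∉ closedBall (0 : E) R,
      ‖w x‖ ≤ K * dist x y := by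
    intro x hx y hy
    -- the segment from `x` to `y` leaves the ball through a point of the sphere
    have hcont : ContinuousOn (fun t : ℝ ↦ ‖x + t • (y - x)‖) (Icc 0 1) := by fun_prop
    have hR : R ∈ Icc ‖x + (0 : ℝ) • (y - x)‖ ‖x + (1 : ℝ) • (y - x)‖ := by
      simp at hx hy ⊢
      exact ⟨hx, hy.le⟩
    obtain ⟨t, ht, htR⟩ := intermediate_value_Icc zero_le_one hcont hR
    have hz : x + t • (y - x) ∈ sphere (0 : E) R := by simpa using htR
    have h1 := hw.dist_le_mul x hx _ (sphere_subset_closedBall hz)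
    rw [h0 _ hz, dist_zero_right] at h1
    refine h1.trans ?_
    gcongr
    rw [dist_eq_norm, dist_eq_norm, sub_add_cancel_left, norm_neg, norm_smul,
      ← norm_neg (x - y), neg_sub, Real.norm_of_nonneg ht.1]
    exact mul_le_of_le_one_left (norm_nonneg _) ht.2
  refine LipschitzWith.of_dist_le_mul fun x y ↦ ?_
  by_cases hx : x ∈ closedBall (0 : E) R <;> by_cases hy : y ∈ closedBall (0 : E) R
  · simpa [indicator_of_mem hx, indicator_of_mem hy] using hw.dist_le_mul x hx y hy
  · simpa [indicator_of_mem hx, indicator_of_notMem hy] using key x hx y hy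
  · rw [dist_comm, dist_comm x y]
    simpa [indicator_of_mem hy, indicator_of_notMem hx] using key y hy x hx
  · simp only [indicator_of_notMem hx, indicator_of_notMem hy, dist_self]
    positivity

/-- A Lipschitz perturbation `x ↦ x + g x` of the identity, of constant `< 1`, is bijective. -/
theorem bijective_id_add_of_lipschitzWith {E : Type*} [NormedAddCommGroup E] [NormedSpace ℝ E]
    [CompleteSpace E] {g : E → E} {c : ℝ≥0} (hg : LipschitzWith c g) (hc : c < 1) :
    Function.Bijective fun x ↦ x + g x := by
  constructor
  · intro x y hxy
    have h1 : dist (g x) (g y) = dist x y := by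
      have h2 : x - y = -(g x - g y) := by
        have h3 : x + g x = y + g y := hxy
        rw [neg_sub, sub_eq_sub_iff_add_eq_add, h3, add_comm]
      rw [dist_eq_norm, dist_eq_norm, h2, norm_neg]
    have h2 := hg.dist_le_mul x y
    rw [h1] at h2
    have h3 : (c : ℝ) < 1 := by exact_mod_cast hc
    have h4 : dist x y ≤ 0 := by nlinarith [dist_nonneg (x := x) (y := y)]
    exact dist_le_zero.1 h4
  · intro y
    have hF : ContractingWith c fun x ↦ y - g x := by
      refine ⟨hc, LipschitzWith.of_dist_le_mul fun a b ↦ ?_⟩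
      rw [dist_sub_left]
      exact hg.dist_le_mul a b
    refine ⟨hF.fixedPoint, ?_⟩
    have := hF.fixedPoint_isFixedPt
    have h : y - g hF.fixedPoint = hF.fixedPoint := this
    simp only
    nth_rw 1 [← h]
    abel

/-- There is no `C^1` retraction of a ball onto its boundary sphere. If `r` is one, then for small
`t` the map `x ↦ x + t (r x - x)` is a bijection of the ball, so the integral of its Jacobian,
a polynomial in `t`, is the volume of the ball for all `t`; but at `t = 1` the Jacobian vanishes,
since `r` takes values in a sphere. -/
theorem not_exists_contDiff_retraction {E : Type*} [NormedAddCommGroup E] [InnerProductSpace ℝ E]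
    [FiniteDimensional ℝ E] {R : ℝ} (hR : 0 < R) {r : E → E} (hr : ContDiff ℝ 1 r)
    (hrR : ∀ x ∈ closedBall (0 : E) R, ‖r x‖ = R) (hrs : ∀ x ∈ sphere (0 : E) R, r x = x) :
    False := by
  borelize E
  let w : E → E := fun x ↦ r x - x
  have hw : ContDiff ℝ 1 w := hr.sub contDiff_id
  obtain ⟨K, hK⟩ := hw.contDiffOn.exists_lipschitzOnWith one_ne_zero
    (convex_closedBall (0 : E) R) (isCompact_closedBall _ _)
  have hws : ∀ x ∈ sphere (0 : E) R, w x = 0 := fun x hx ↦ by simp [w, hrs x hx]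
  have hL := lipschitzWith_indicator_closedBall hK hws
  set W := (closedBall (0 : E) R).indicator w with hW
  have hWout : ∀ x ∉ ball (0 : E) R, W x = 0 := by
    intro x hx
    by_cases h : x ∈ closedBall (0 : E) R
    · rw [hW, indicator_of_mem h]
      refine hws x ?_
      simp at hx h ⊢
      exact le_antisymm h hx
    · exact indicator_of_notMem h _
  have hWin : ∀ x ∈ ball (0 : E) R, W x = w x := fun x hx ↦
    indicator_of_mem (ball_subset_closedBall hx) _
  let A : E → E →L[ℝ] E := fderiv ℝ w
  have hA : Continuous A := hw.continuous_fderiv one_ne_zero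
  have hAK : ∀ x ∈ ball (0 : E) R, ‖A x‖ ≤ K := fun x hx ↦
    norm_fderiv_le_of_lipschitzOn ℝ (isOpen_ball.mem_nhds hx) (hK.mono ball_subset_closedBall)
  have hdet : Continuous fun X : E →L[ℝ] E ↦ (ContinuousLinearMap.id ℝ E + X).det :=
    ContinuousLinearMap.continuous_det.comp (continuous_const.add continuous_id)
  obtain ⟨ε, hε, hεdet⟩ : ∃ ε > 0, ∀ X : E →L[ℝ] E, ‖X‖ < ε →
      0 < (ContinuousLinearMap.id ℝ E + X).det := by
    have h0 : 0 < (ContinuousLinearMap.id ℝ E + (0 : E →L[ℝ] E)).det := by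
      simp [ContinuousLinearMap.det]
    obtain ⟨ε, hε, h⟩ := Metric.eventually_nhds_iff.1
      (hdet.continuousAt.eventually (lt_mem_nhds h0))
    exact ⟨ε, hε, fun X hX ↦ h (by simpa using hX)⟩
  obtain ⟨t₀, ht₀, ht₀1, ht₀ε⟩ : ∃ t₀ : ℝ, 0 < t₀ ∧ t₀ * K < 1 ∧ t₀ * K < ε := by
    have hK1 : (0 : ℝ) < K + 1 := by positivity
    refine ⟨min 1 ε / (K + 1), by positivity, ?_, ?_⟩
    · rw [div_mul_eq_mul_div, div_lt_iff₀ hK1]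
      nlinarith [min_le_left 1 ε, K.2, lt_min one_pos hε]
    · rw [div_mul_eq_mul_div, div_lt_iff₀ hK1]
      nlinarith [min_le_right 1 ε, K.2, lt_min one_pos hε]
  let q : ℝ → E → ℝ := fun t x ↦ (ContinuousLinearMap.id ℝ E + t • A x).det
  have hq : ∀ t, Continuous (q t) := fun t ↦ hdet.comp (hA.const_smul t)
  have hqi : ∀ t, IntegrableOn (q t) (ball 0 R) volume := fun t ↦
    ((hq t).continuousOn.integrableOn_compact (isCompact_closedBall (0 : E) R)).mono_set
      ball_subset_closedBall
  -- the Jacobian integral is the volume for small `t`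
  have hsmall : ∀ t ∈ Icc 0 t₀, ∫ x in ball (0 : E) R, q t x = volume.real (ball (0 : E) R) := by
    intro t ht
    have htK : t * K ≤ t₀ * K := mul_le_mul_of_nonneg_right ht.2 K.2
    let f : E → E := fun x ↦ x + t • W x
    have hbij : Function.Bijective f := by
      have h1 : LipschitzWith (t.toNNReal * K) fun x ↦ t • W x := by
        refine LipschitzWith.of_dist_le_mul fun x y ↦ ?_
        rw [dist_smul₀, Real.norm_of_nonneg ht.1, NNReal.coe_mul, Real.coe_toNNReal _ ht.1,
          mul_assoc]
        exact mul_le_mul_of_nonneg_left (hL.dist_le_mul x y) ht.1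
      refine bijective_id_add_of_lipschitzWith h1 ?_
      rw [← NNReal.coe_lt_coe, NNReal.coe_mul, Real.coe_toNNReal _ ht.1]
      exact htK.trans_lt ht₀1
    have hfix : ∀ x ∉ ball (0 : E) R, f x = x := fun x hx ↦ by simp [f, hWout x hx]
    have himg : f '' ball 0 R = ball 0 R := by
      have h1 : f '' (ball 0 R)ᶜ = (ball 0 R)ᶜ := by
        have h2 : EqOn f id (ball 0 R)ᶜ := fun x hx ↦ hfix x hx
        rw [h2.image_eq, image_id]
      rw [← compl_inj_iff, ← image_compl_eq hbij, h1]
    have hder : ∀ x ∈ ball (0 : E) R,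
        HasFDerivWithinAt f (ContinuousLinearMap.id ℝ E + t • A x) (ball 0 R) x := by
      intro x hx
      have h1 : HasFDerivAt w (A x) x := (hw.differentiable one_ne_zero x).hasFDerivAt
      have h2 : HasFDerivAt (fun x ↦ x + t • w x) (ContinuousLinearMap.id ℝ E + t • A x) x :=
        (hasFDerivAt_id x).add (h1.const_smul t)
      refine h2.hasFDerivWithinAt.congr (fun y hy ↦ ?_) ?_
      · simp [f, hWin y hy]
      · simp [f, hWin x hx]
    have h := integral_image_eq_integral_abs_det_fderiv_smul volume measurableSet_ball hder
      hbij.1.injOn (fun _ ↦ (1 : ℝ))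
    rw [himg] at h
    have h2 : ∫ x in ball (0 : E) R, q t x = ∫ x in ball (0 : E) R,
        |(ContinuousLinearMap.id ℝ E + t • A x).det| • (1 : ℝ) := by
      refine setIntegral_congr_fun measurableSet_ball fun x hx ↦ ?_
      have hpos : 0 < (ContinuousLinearMap.id ℝ E + t • A x).det := by
        refine hεdet _ ?_
        rw [norm_smul, Real.norm_of_nonneg ht.1]
        exact (mul_le_mul_of_nonneg_left (hAK x hx) ht.1).trans_lt (htK.trans_lt ht₀ε)
      simp [q, abs_of_pos hpos]
    rw [h2, ← h]
    simp
  -- hence for `t = 1`, by Lagrange interpolation at nodes in `[0, t₀]`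
  let m := Module.finrank ℝ E
  let v : ℕ → ℝ := fun i ↦ t₀ * (i / (m + 1))
  have hv : InjOn v (Finset.range (m + 1)) := by
    intro i _ j _ hij
    have : (i : ℝ) / (m + 1) = j / (m + 1) := mul_left_cancel₀ ht₀.ne' hij
    have hm : (m + 1 : ℝ) ≠ 0 := by positivity
    rw [div_left_inj' hm] at this
    exact_mod_cast this
  have hvI : ∀ i ∈ Finset.range (m + 1), v i ∈ Icc 0 t₀ := by
    intro i hi
    have hi' : (i : ℝ) ≤ m + 1 := by exact_mod_cast (Finset.mem_range.1 hi).le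
    refine ⟨by positivity, mul_le_of_le_one_right ht₀.le ?_⟩
    exact div_le_one_of_le₀ hi' (by positivity)
  let c : ℕ → ℝ := fun i ↦ (Lagrange.basis (Finset.range (m + 1)) v i).eval 1
  have hc : ∑ i ∈ Finset.range (m + 1), c i = 1 := by
    have := congrArg (Polynomial.eval (1 : ℝ))
      (Lagrange.sum_basis hv ⟨0, Finset.mem_range.2 (Nat.succ_pos m)⟩)
    simpa [Polynomial.eval_finsetSum, c] using this
  have hq1 : ∀ x, q 1 x = ∑ i ∈ Finset.range (m + 1), q (v i) x * c i := by
    intro x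
    obtain ⟨p, hpd, hp⟩ := exists_polynomial_eval_eq_det_one_add_smul (A x)
    have hdeg : p.degree < (Finset.range (m + 1)).card := by
      rw [Finset.card_range]
      exact (Polynomial.degree_le_of_natDegree_le hpd).trans_lt
        (by exact_mod_cast Nat.lt_succ_self m)
    have h := congrArg (Polynomial.eval (1 : ℝ)) (Lagrange.eq_interpolate hv hdeg)
    rw [hp, Lagrange.interpolate_apply, Polynomial.eval_finsetSum] at h
    simpa [hp, q, c] using h
  have hint : ∫ x in ball (0 : E) R, q 1 x = volume.real (ball (0 : E) R) := by
    simp_rw [hq1]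
    rw [integral_finsetSum _ fun i _ ↦ (hqi (v i)).mul_const (c i)]
    simp_rw [integral_mul_const]
    rw [Finset.sum_congr rfl fun i hi ↦ by rw [hsmall _ (hvI i hi)], ← Finset.mul_sum, hc,
      mul_one]
  -- but the Jacobian of `r` vanishes on the ball
  have hzero : ∫ x in ball (0 : E) R, q 1 x = 0 := by
    refine setIntegral_eq_zero_of_forall_eq_zero fun x hx ↦ ?_
    have hrx : HasFDerivAt r (ContinuousLinearMap.id ℝ E + (1 : ℝ) • A x) x := by
      have h1 : HasFDerivAt w (A x) x := (hw.differentiable one_ne_zero x).hasFDerivAt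
      rw [one_smul]
      refine ((hasFDerivAt_id x).add h1).congr_of_eventuallyEq (Filter.Eventually.of_forall ?_)
      intro y
      simp [w]
    by_contra hne
    have hsurj : Function.Surjective (ContinuousLinearMap.id ℝ E + (1 : ℝ) • A x) :=
      (LinearEquiv.ofIsUnitDet (f := (ContinuousLinearMap.id ℝ E + (1 : ℝ) • A x).toLinearMap)
        (v := Module.finBasis ℝ E) (v' := Module.finBasis ℝ E) (by
          rw [LinearMap.det_toMatrix]; exact isUnit_iff_ne_zero.2 hne)).surjective
    obtain ⟨z, hz⟩ := hsurj (r x)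
    have h1 : HasFDerivAt (fun y ↦ ‖r y‖ ^ 2)
        (2 • (innerSL ℝ (r x)).comp (ContinuousLinearMap.id ℝ E + (1 : ℝ) • A x)) x :=
      hrx.norm_sq
    have h2 : HasFDerivAt (fun y ↦ ‖r y‖ ^ 2) (0 : E →L[ℝ] ℝ) x := by
      refine (hasFDerivAt_const (R ^ 2) x).congr_of_eventuallyEq ?_
      filter_upwards [isOpen_ball.mem_nhds hx] with y hy
      rw [hrR y (ball_subset_closedBall hy)]
    have h3 := congrArg (fun L : E →L[ℝ] ℝ ↦ L z) (h1.unique h2)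
    simp only [smul_apply, ContinuousLinearMap.comp_apply, hz,
      innerSL_apply_apply, real_inner_self_eq_norm_sq, zero_apply] at h3
    rw [hrR x (ball_subset_closedBall hx)] at h3
    simp at h3
    exact hR.ne' h3
  rw [hzero] at hint
  have hpos : 0 < volume.real (ball (0 : E) R) :=
    ENNReal.toReal_pos (measure_ball_pos volume _ hR).ne' measure_ball_lt_top.ne
  exact hpos.ne hint

/-- **No-retraction theorem**: a continuous map from a closed ball that is the identity on the
sphere takes the value `0`. -/
theorem exists_eq_zero_of_eq_id_on_sphere {E : Type*} [NormedAddCommGroup E]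
    [InnerProductSpace ℝ E] [FiniteDimensional ℝ E] {ρ : ℝ} (hρ : 0 < ρ) {f : E → E}
    (hf : ContinuousOn f (closedBall 0 ρ)) (hs : ∀ x ∈ sphere (0 : E) ρ, f x = x) :
    ∃ x ∈ closedBall (0 : E) ρ, f x = 0 := by
  by_contra! hne
  -- extend by the identity
  let F : E → E := fun x ↦ if ‖x‖ ≤ ρ then f x else x
  have hFc : Continuous F := by
    refine continuous_if (fun x hx ↦ ?_) ?_ continuousOn_id
    · refine hs x ?_
      have := frontier_le_subset_eq continuous_norm continuous_const hx
      simpa using this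
    · have h1 : IsClosed {x : E | ‖x‖ ≤ ρ} := isClosed_le continuous_norm continuous_const
      rw [h1.closure_eq]
      exact hf.mono fun x hx ↦ by simpa using hx
  have hF0 : ∀ x, F x ≠ 0 := by
    intro x
    by_cases h : ‖x‖ ≤ ρ
    · simp only [F, if_pos h]
      exact hne x (by simpa using h)
    · simp only [F, if_neg h]
      rintro rfl
      simp [hρ.le] at h
  -- smooth `F`, keeping it nonzero, and the identity away from the ball
  have hS : IsClosed {x : E | 2 * ρ ≤ ‖x‖} := isClosed_le continuous_const continuous_norm
  have hU : {x : E | ρ < ‖x‖} ∈ nhdsSet {x : E | 2 * ρ ≤ ‖x‖} := by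
    refine (isOpen_lt continuous_const continuous_norm).mem_nhdsSet.2 fun x hx ↦ ?_
    simp only [mem_ofPred_eq] at hx ⊢
    linarith
  have hFU : ContDiffOn ℝ ((1 : ℕ∞) : WithTop ℕ∞) F {x : E | ρ < ‖x‖} :=
    contDiffOn_id.congr fun x hx ↦ if_neg (not_le.2 hx)
  obtain ⟨G, hG, hGF, hGS, -⟩ := hFc.exists_contDiff_approx_and_eqOn 1 hFc.norm
    (fun x ↦ norm_pos_iff.2 (hF0 x)) hS hU hFU
  have hG0 : ∀ x, G x ≠ 0 := by
    intro x hx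
    have := hGF x
    rw [hx, dist_zero_left] at this
    exact lt_irrefl _ this
  have h2ρ : 0 < 2 * ρ := by positivity
  refine not_exists_contDiff_retraction h2ρ (r := fun x ↦ (2 * ρ * ‖G x‖⁻¹) • G x) ?_ ?_ ?_
  · have hG1 : ContDiff ℝ 1 G := hG
    exact (contDiff_const.mul ((hG1.norm ℝ hG0).inv fun x ↦ norm_ne_zero_iff.2 (hG0 x))).smul hG1
  · intro x _
    rw [norm_smul, norm_mul, norm_inv, norm_norm, mul_assoc,
      inv_mul_cancel₀ (norm_ne_zero_iff.2 (hG0 x)), mul_one, Real.norm_of_nonneg h2ρ.le]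
  · intro x hx
    have hx' : ‖x‖ = 2 * ρ := by simpa using hx
    have hGx : G x = x := by
      rw [hGS (show 2 * ρ ≤ ‖x‖ from hx'.ge)]
      simp only [F]
      rw [if_neg]
      linarith
    simp only [hGx, hx']
    rw [mul_inv_cancel₀ h2ρ.ne', one_smul]

end NoRetraction

end ParallelExt

/-! ### The equation `Dg = B g` across a hyperplane -/

namespace ParallelExt

section LinearEquation

open Filter

variable {G V : Type*} [NormedAddCommGroup G] [NormedSpace ℝ G] [NormedAddCommGroup V]
  [NormedSpace ℝ V]

/-- Grönwall's inequality along the segments of a convex set. -/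
theorem norm_le_mul_exp_of_hasFDerivWithinAt {O : Set G} (hO : Convex ℝ O)
    {B : G → V →L[ℝ] G →L[ℝ] V} {C : ℝ} (hB : ∀ y ∈ O, ‖B y‖ ≤ C) {g : G → V}
    (hg : ∀ y ∈ O, HasFDerivWithinAt g (B y (g y)) O y) {x y : G} (hx : x ∈ O) (hy : y ∈ O) :
    ‖g y‖ ≤ ‖g x‖ * Real.exp (C * ‖y - x‖) := by
  let γ : ℝ → G := fun t ↦ x + t • (y - x)
  have hγO : MapsTo γ (Icc 0 1) O := fun t ht ↦ by
    have := hO.add_smul_sub_mem hx hy ht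
    exact this
  have hγ : ∀ t, HasDerivAt γ (y - x) t := fun t ↦ by
    have h := ((hasDerivAt_id t).smul_const (y - x)).const_add x
    rw [one_smul] at h
    exact h
  have hd : ∀ t ∈ Icc (0 : ℝ) 1,
      HasDerivWithinAt (g ∘ γ) (B (γ t) (g (γ t)) (y - x)) (Icc 0 1) t := fun t ht ↦
    (hg _ (hγO ht)).comp_hasDerivWithinAt t (hγ t).hasDerivWithinAt hγO
  have h := norm_le_gronwallBound_of_norm_deriv_right_le (f := g ∘ γ) (δ := ‖g x‖)
    (K := C * ‖y - x‖) (ε := 0) (a := 0) (b := 1)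
    (fun t ht ↦ (hd t ht).continuousWithinAt)
    (fun t ht ↦ (hd t (Ico_subset_Icc_self ht)).mono_of_mem_nhdsWithin
      (mem_of_superset (Ico_mem_nhdsGE_of_mem ht) Ico_subset_Icc_self))
    (by simp [γ]) (fun t ht ↦ by
      rw [add_zero, mul_right_comm]
      refine ((B (γ t) (g (γ t))).le_opNorm _).trans ?_
      gcongr
      refine ((B (γ t)).le_opNorm _).trans ?_
      exact mul_le_mul_of_nonneg_right (hB _ (hγO (Ico_subset_Icc_self ht)))
        (norm_nonneg _)) 1 ⟨zero_le_one, le_rfl⟩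
  simpa [γ, gronwallBound_ε0] using h

/-- A solution on a bounded open convex set extends to the closure, as a solution. -/
theorem exists_extension_closure [FiniteDimensional ℝ V] {H : Set G} (hH : Convex ℝ H)
    (hHo : IsOpen H) (hHb : Bornology.IsBounded H)
    {B : G → V →L[ℝ] G →L[ℝ] V} {C : ℝ} (hB : ∀ y ∈ H, ‖B y‖ ≤ C) {g : G → V}
    (hg : ∀ y ∈ H, HasFDerivAt g (B y (g y)) y) :
    ∃ s : G → V, Continuous s ∧ EqOn g s H ∧
      ∀ x, ContinuousAt B x → HasFDerivWithinAt s (B x (s x)) (closure H) x := by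
  obtain ⟨K, hK⟩ : ∃ K : NNReal, LipschitzOnWith K g H := by
    rcases H.eq_empty_or_nonempty with rfl | ⟨x₀, hx₀⟩
    · exact ⟨0, by simp⟩
    obtain ⟨R, hR⟩ := hHb.subset_closedBall x₀
    have hC : 0 ≤ C := (norm_nonneg (B x₀)).trans (hB x₀ hx₀)
    have hbd : ∀ y ∈ H, ‖g y‖ ≤ ‖g x₀‖ * Real.exp (C * R) := by
      intro y hy
      refine (norm_le_mul_exp_of_hasFDerivWithinAt hH hB
        (fun y hy ↦ (hg y hy).hasFDerivWithinAt) hx₀ hy).trans ?_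
      gcongr
      rw [← dist_eq_norm]
      exact hR hy
    refine ⟨(C * (‖g x₀‖ * Real.exp (C * R))).toNNReal,
      hH.lipschitzOnWith_of_nnnorm_hasFDerivWithin_le
        (fun y hy ↦ (hg y hy).hasFDerivWithinAt) fun y hy ↦ ?_⟩
    rw [← NNReal.coe_le_coe, Real.coe_toNNReal _ (by positivity), coe_nnnorm]
    refine ((B y).le_opNorm _).trans ?_
    exact mul_le_mul (hB y hy) (hbd y hy) (norm_nonneg _) hC
  obtain ⟨s, hs, hgs⟩ := hK.extend_finite_dimension
  have hsc := hs.continuous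
  refine ⟨s, hsc, hgs, fun x hBx ↦ ?_⟩
  have hsd : ∀ y ∈ H, HasFDerivAt s (B y (s y)) y := by
    intro y hy
    rw [← hgs hy]
    exact (hg y hy).congr_of_eventuallyEq (hgs.symm.eventuallyEq_of_mem (hHo.mem_nhds hy))
  refine hasFDerivWithinAt_closure_of_tendsto_fderiv
    (fun y hy ↦ (hsd y hy).differentiableAt.differentiableWithinAt) hH hHo
    (fun y _ ↦ hsc.continuousWithinAt) ?_
  have h1 : Tendsto (fun y ↦ B y (s y)) (𝓝[H] x) (𝓝 (B x (s x))) :=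
    ((hBx.clm_apply hsc.continuousAt).tendsto).mono_left nhdsWithin_le_nhds
  refine h1.congr' ?_
  filter_upwards [self_mem_nhdsWithin] with y hy
  exact (hsd y hy).fderiv.symm

/-- In an open set `O`, a point where the nonzero functional `ℓ` is nonnegative is in the
closure of the part of `O` where `ℓ` is positive. -/
theorem mem_closure_inter_pos {O : Set G} (hO : IsOpen O) {ℓ : G →L[ℝ] ℝ} (hℓ : ℓ ≠ 0)
    {y : G} (hy : y ∈ O) (hy0 : 0 ≤ ℓ y) : y ∈ closure (O ∩ {x | 0 < ℓ x}) := by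
  obtain ⟨u, hu⟩ : ∃ u, 0 < ℓ u := by
    obtain ⟨u, hu⟩ : ∃ u, ℓ u ≠ 0 := by
      by_contra! h
      exact hℓ (ContinuousLinearMap.ext h)
    rcases hu.lt_or_gt with h | h
    · exact ⟨-u, by simpa using h⟩
    · exact ⟨u, h⟩
  have h1 : Tendsto (fun t : ℝ ↦ y + t • u) (𝓝[>] 0) (𝓝 y) := by
    have : ContinuousAt (fun t : ℝ ↦ y + t • u) 0 := by fun_prop
    simpa [ContinuousAt] using this.tendsto.mono_left (nhdsWithin_le_nhds (s := Ioi 0))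
  refine mem_closure_of_tendsto h1 ?_
  filter_upwards [h1 (hO.mem_nhds hy), self_mem_nhdsWithin] with t ht ht0
  refine ⟨ht, ?_⟩
  have : 0 < t * ℓ u := mul_pos ht0 hu
  simp only [mem_ofPred_eq, map_add, map_smul, smul_eq_mul]
  linarith

/-- A solution of `Dg = B g` defined off a hyperplane extends across the hyperplane as soon as it
has a continuous extension near one point of it: the solutions on the two sides extend to the
hyperplane, and there they satisfy the same linear equation. -/
theorem exists_extension_across_hyperplane [FiniteDimensional ℝ V] {O : Set G}
    (hO : Convex ℝ O) (hOo : IsOpen O) (hOb : Bornology.IsBounded O)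
    {B : G → V →L[ℝ] G →L[ℝ] V} {C : ℝ} (hBc : ContinuousOn B O) (hB : ∀ y ∈ O, ‖B y‖ ≤ C)
    {ℓ : G →L[ℝ] ℝ} (hℓ : ℓ ≠ 0) {g : G → V}
    (hg : ∀ y ∈ O, ℓ y ≠ 0 → HasFDerivAt g (B y (g y)) y)
    {z : G} (hz : z ∈ O) (hz0 : ℓ z = 0) {h : G → V} (hh : ContinuousAt h z)
    (hhg : ∀ᶠ y in 𝓝 z, ℓ y ≠ 0 → h y = g y) :
    ∃ τ : G → V, (∀ y ∈ O, HasFDerivAt τ (B y (τ y)) y) ∧ ∀ y ∈ O, ℓ y ≠ 0 → τ y = g y := by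
  -- each side, given by a functional `m` vanishing on the hyperplane only
  have side : ∀ m : G →L[ℝ] ℝ, m ≠ 0 → (∀ y, ℓ y = 0 ↔ m y = 0) →
      ∃ s : G → V, Continuous s ∧ (∀ y ∈ O, 0 < m y → g y = s y) ∧ s z = h z ∧
        ∀ x ∈ O, HasFDerivWithinAt s (B x (s x)) (O ∩ {y | 0 ≤ m y}) x := by
    intro m hm hmℓ
    have hHo : IsOpen (O ∩ {y | 0 < m y}) :=
      hOo.inter (isOpen_lt continuous_const m.continuous)
    have hHc : Convex ℝ (O ∩ {y | 0 < m y}) :=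
      hO.inter (convex_halfSpace_gt m.isLinear 0)
    obtain ⟨s, hsc, hgs, hs⟩ := exists_extension_closure hHc hHo (hOb.subset inter_subset_left)
      (fun y hy ↦ hB y hy.1) (g := g)
      (fun y hy ↦ hg y hy.1 fun h0 ↦ hy.2.ne' ((hmℓ y).1 h0))
    refine ⟨s, hsc, fun y hy hy0 ↦ hgs ⟨hy, hy0⟩, ?_, fun x hx ↦ ?_⟩
    · have hzc := mem_closure_inter_pos hOo hm hz ((hmℓ z).1 hz0).ge
      have := mem_closure_iff_nhdsWithin_neBot.1 hzc
      refine tendsto_nhds_unique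
        (hsc.continuousAt.tendsto.mono_left (nhdsWithin_le_nhds (s := O ∩ {y | 0 < m y})))
        ((hh.tendsto.mono_left nhdsWithin_le_nhds).congr' ?_)
      filter_upwards [self_mem_nhdsWithin, mem_nhdsWithin_of_mem_nhds hhg] with y hy hy'
      rw [hy' fun h0 ↦ hy.2.ne' ((hmℓ y).1 h0), hgs hy]
    · exact (hs x (hBc.continuousAt (hOo.mem_nhds hx))).mono
        fun y hy ↦ mem_closure_inter_pos hOo hm hy.1 hy.2
  obtain ⟨s₁, hs₁c, hs₁g, hs₁z, hs₁⟩ := side ℓ hℓ fun y ↦ Iff.rfl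
  obtain ⟨s₂, hs₂c, hs₂g, hs₂z, hs₂⟩ := side (-ℓ) (neg_ne_zero.2 hℓ) fun y ↦ by simp
  -- the two extensions agree on the hyperplane
  have heq : ∀ y ∈ O, ℓ y = 0 → s₁ y = s₂ y := by
    intro y hy hy0
    have hPc : Convex ℝ (O ∩ {y | ℓ y = 0}) := hO.inter (convex_hyperplane ℓ.isLinear 0)
    have h1 := norm_le_mul_exp_of_hasFDerivWithinAt hPc (fun y hy ↦ hB y hy.1)
      (g := fun y ↦ s₁ y - s₂ y) (fun y hy ↦ by
        rw [map_sub]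
        refine ((hs₁ y hy.1).mono ?_).sub ((hs₂ y hy.1).mono ?_)
        · exact fun x hx ↦ ⟨hx.1, hx.2.ge⟩
        · exact fun x hx ↦ ⟨hx.1, by simp [show ℓ x = 0 from hx.2]⟩)
      (x := z) (y := y) ⟨hz, hz0⟩ ⟨hy, hy0⟩
    rw [hs₁z, hs₂z, sub_self, norm_zero, zero_mul] at h1
    exact sub_eq_zero.1 (norm_le_zero_iff.1 h1)
  let τ : G → V := fun y ↦ if 0 ≤ ℓ y then s₁ y else s₂ y
  have hτ₁ : ∀ y, 0 ≤ ℓ y → τ y = s₁ y := fun y hy ↦ if_pos hy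
  have hτ₂ : ∀ y ∈ O, 0 ≤ (-ℓ) y → τ y = s₂ y := by
    intro y hyO hy
    rw [neg_apply, Left.nonneg_neg_iff] at hy
    rcases hy.lt_or_eq with h0 | h0
    · exact if_neg (not_le.2 h0)
    · rw [hτ₁ y h0.ge, heq y hyO h0]
  have hτg : ∀ y ∈ O, ℓ y ≠ 0 → τ y = g y := by
    intro y hy hy0
    rcases hy0.lt_or_gt with h0 | h0
    · rw [hτ₂ y hy (by simpa using h0.le), hs₂g y hy (by simpa using h0)]
    · rw [hτ₁ y h0.le, hs₁g y hy h0]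
  refine ⟨τ, fun y hy ↦ ?_, hτg⟩
  by_cases hy0 : ℓ y = 0
  · have h₁ : HasFDerivWithinAt τ (B y (τ y)) (O ∩ {y | 0 ≤ ℓ y}) y := by
      rw [hτ₁ y hy0.ge]
      exact (hs₁ y hy).congr (fun x hx ↦ hτ₁ x hx.2) (hτ₁ y hy0.ge)
    have h₂ : HasFDerivWithinAt τ (B y (τ y)) (O ∩ {y | 0 ≤ (-ℓ) y}) y := by
      have h0 : 0 ≤ (-ℓ) y := by simp [hy0]
      rw [hτ₂ y hy h0]
      exact (hs₂ y hy).congr (fun x hx ↦ hτ₂ x hx.1 hx.2) (hτ₂ y hy h0)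
    refine (h₁.union h₂).hasFDerivAt (mem_of_superset (hOo.mem_nhds hy) fun x hx ↦ ?_)
    rcases le_total 0 (ℓ x) with h0 | h0
    · exact Or.inl ⟨hx, h0⟩
    · exact Or.inr ⟨hx, by simpa using h0⟩
  · rw [hτg y hy hy0]
    refine (hg y hy hy0).congr_of_eventuallyEq ?_
    filter_upwards [hOo.mem_nhds hy, ℓ.continuous.continuousAt.eventually_ne hy0] with x hx hx0
    exact hτg x hx hx0

end LinearEquation

end ParallelExt

/-! ### Connections in coordinates -/

namespace ParallelExt

section LocalForm

variable {n : ℕ} {M : Type u} [TopologicalSpace M] [ChartedSpace (EuclideanSpace ℝ (Fin n)) M]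
  {V : Type v} [NormedAddCommGroup V] [NormedSpace ℝ V]
  {E : M → Type v} [TopologicalSpace (TotalSpace V E)]
  [∀ x, AddCommGroup (E x)] [∀ x, Module ℝ (E x)] [∀ x, TopologicalSpace (E x)]
  [∀ x, IsTopologicalAddGroup (E x)] [∀ x, ContinuousSMul ℝ (E x)]
  [FiberBundle V E] [VectorBundle ℝ V E]

/-- The Leibniz rule for a finite sum `∑ fᵢ sᵢ`. -/
theorem cov_sum_smul [ContMDiffVectorBundle 1 V E (𝓡 n)] (cov : CovariantDerivative (𝓡 n) V E)
    {ι : Type*} (t : Finset ι)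
    {s : ι → (x : M) → E x} {f : ι → M → ℝ} {x : M}
    (hf : ∀ i, MDifferentiableAt (𝓡 n) 𝓘(ℝ, ℝ) (f i) x)
    (hs : ∀ i, MDifferentiableAt (𝓡 n) ((𝓡 n).prod 𝓘(ℝ, V))
      (fun y ↦ TotalSpace.mk' V y (s i y)) x) :
    cov (fun y ↦ ∑ i ∈ t, f i y • s i y) x
      = ∑ i ∈ t, (f i x • cov (s i) x + (mvfderiv (𝓡 n) (f i) x).smulRight (s i x)) := by
  classical
  induction t using Finset.induction_on with
  | empty =>
    simp only [Finset.sum_empty]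
    exact cov.isCovariantDerivativeOnUniv.zero
  | insert i t hi ih =>
    have h1 : (fun y ↦ ∑ j ∈ insert i t, f j y • s j y)
        = f i • s i + fun y ↦ ∑ j ∈ t, f j y • s j y := by
      funext y
      simp [Finset.sum_insert hi]
    have h2 : MDifferentiableAt (𝓡 n) ((𝓡 n).prod 𝓘(ℝ, V))
        (fun y ↦ TotalSpace.mk' V y (∑ j ∈ t, f j y • s j y)) x :=
      MDifferentiableAt.sum_section fun j _ ↦ (hf j).smul_section (hs j)
    rw [h1, cov.isCovariantDerivativeOnUniv.add ((hf i).smul_section (hs i)) h2,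
      cov.isCovariantDerivativeOnUniv.leibniz (hs i) (hf i), ih, Finset.sum_insert hi]

variable [IsManifold (𝓡 n) 1 M] {G : Type*} [NormedAddCommGroup G] [NormedSpace ℝ G]

/-- The section `σ` of `E`, read in the chart `φ` of the base and in the trivialization `e`. -/
def readSection (φ : OpenPartialHomeomorph M G) (e : Trivialization V (π V E))
    (σ : (x : M) → E x) (y : G) : V :=
  (e ⟨φ.symm y, σ (φ.symm y)⟩).2

/-- In coordinates, a connection that maps `C^1` sections to continuous ones is `D - B` for some
continuous `B`, given by the derivatives of a local frame. -/
theorem exists_coordinate_form [FiniteDimensional ℝ V] [FiniteDimensional ℝ G]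
    [ContMDiffVectorBundle 1 V E (𝓡 n)] (cov : CovariantDerivative (𝓡 n) V E)
    (hcov : MapsSections 1 0 cov) (φ : OpenPartialHomeomorph M G)
    (hφ : ContMDiffOn (𝓡 n) 𝓘(ℝ, G) 1 φ φ.source)
    (hφs : ContMDiffOn 𝓘(ℝ, G) (𝓡 n) 1 φ.symm φ.target)
    (e : Trivialization V (π V E)) [MemTrivializationAtlas e] :
    ∃ B : G → V →L[ℝ] G →L[ℝ] V,
      ContinuousOn B (φ.target ∩ φ.symm ⁻¹' e.baseSet) ∧
      ∀ (σ : (x : M) → E x), ∀ y ∈ φ.target ∩ φ.symm ⁻¹' e.baseSet,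
        MDifferentiableAt (𝓡 n) ((𝓡 n).prod 𝓘(ℝ, V)) (fun x ↦ TotalSpace.mk' V x (σ x))
          (φ.symm y) →
          DifferentiableAt ℝ (readSection φ e σ) y ∧
          (cov σ (φ.symm y) = 0 ↔
            fderiv ℝ (readSection φ e σ) y = B y (readSection φ e σ y)) := by
  let b := Module.finBasis ℝ V
  let s : Fin (Module.finrank ℝ V) → (x : M) → E x := fun i x ↦ e.symmL ℝ x (b i)
  have hes : ∀ i, ∀ x ∈ e.baseSet, (e ⟨x, s i x⟩).2 = b i := by
    intro i x hx
    rw [← Trivialization.continuousLinearMapAt_apply_of_mem ℝ e hx,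
      e.continuousLinearMapAt_symmL hx]
  have hsC : ∀ i, ContMDiffOn (𝓡 n) ((𝓡 n).prod 𝓘(ℝ, V)) 1
      (fun x ↦ TotalSpace.mk' V x (s i x)) e.baseSet := by
    intro i
    rw [e.contMDiffOn_section_baseSet_iff]
    exact (contMDiffOn_const (c := b i)).congr fun x hx ↦ hes i x hx
  have hsd : ∀ i, ∀ x ∈ e.baseSet, MDifferentiableAt (𝓡 n) ((𝓡 n).prod 𝓘(ℝ, V))
      (fun x ↦ TotalSpace.mk' V x (s i x)) x := fun i x hx ↦
    ((hsC i).contMDiffAt (e.open_baseSet.mem_nhds hx)).mdifferentiableAt one_ne_zero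
  set T : Set G := φ.target ∩ φ.symm ⁻¹' e.baseSet with hT
  -- the connection forms in the frame, in coordinates
  let β : Fin (Module.finrank ℝ V) → G → G →L[ℝ] V := fun i y ↦
    (e.continuousLinearMapAt ℝ (φ.symm y)).comp
      ((cov (s i) (φ.symm y)).comp (mfderiv 𝓘(ℝ, G) (𝓡 n) φ.symm y))
  have hβ : ∀ i, ContinuousOn (β i) T := by
    intro i
    have hT1 : MapsTo φ.symm T e.baseSet := fun y hy ↦ hy.2
    rw [continuousOn_clm_apply]
    intro w
    have h1 : ContMDiffOn 𝓘(ℝ, G) ((𝓡 n).prod 𝓘(ℝ, EuclideanSpace ℝ (Fin n) →L[ℝ] V)) 0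
        (fun y ↦ TotalSpace.mk' (EuclideanSpace ℝ (Fin n) →L[ℝ] V)
          (E := fun x ↦ TangentSpace (𝓡 n) x →L[ℝ] E x) (φ.symm y) (cov (s i) (φ.symm y))) T :=
      (hcov e.baseSet (s i) e.open_baseSet (hsC i)).comp
        ((hφs.of_le zero_le_one).mono inter_subset_left) hT1
    have h2 : ContMDiffOn 𝓘(ℝ, G) ((𝓡 n).prod 𝓘(ℝ, EuclideanSpace ℝ (Fin n))) 0
        (fun y ↦ TotalSpace.mk' (EuclideanSpace ℝ (Fin n)) (E := TangentSpace (𝓡 n)) (φ.symm y)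
          (mfderiv 𝓘(ℝ, G) (𝓡 n) φ.symm y w)) T := by
      rw [contMDiffOn_zero_iff]
      have h3 := hφs.continuousOn_tangentMapWithin le_rfl φ.open_target.uniqueMDiffOn
      have h4 : Continuous fun y : G ↦ (⟨y, w⟩ : TangentBundle 𝓘(ℝ, G) G) :=
        (tangentBundleModelSpaceHomeomorph 𝓘(ℝ, G)).symm.continuous.comp
          (continuous_id.prodMk (continuous_const (y := w)))
      refine (h3.comp h4.continuousOn fun y hy ↦ hy.1).congr fun y hy ↦ ?_
      simp only [Function.comp_apply, tangentMapWithin,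
        mfderivWithin_of_isOpen φ.open_target hy.1]
    have h3 := (ContMDiffOn.clm_bundle_apply h1 h2).continuousOn
    have h4 : ContinuousOn (fun y ↦ (e ⟨φ.symm y, cov (s i) (φ.symm y)
        (mfderiv 𝓘(ℝ, G) (𝓡 n) φ.symm y w)⟩).2) T :=
      continuous_snd.comp_continuousOn (e.continuousOn.comp h3 fun y hy ↦ by
        rw [e.mem_source]; exact hT1 hy)
    refine h4.congr fun y hy ↦ ?_
    exact Trivialization.continuousLinearMapAt_apply_of_mem ℝ e (hT1 hy) _
  let B : G → V →L[ℝ] G →L[ℝ] V := fun y ↦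
    -∑ i, (LinearMap.toContinuousLinearMap (b.coord i)).smulRight (β i y)
  refine ⟨B, ?_, fun σ y hy hσ ↦ ?_⟩
  · refine (continuousOn_finsetSum _ fun i _ ↦ ?_).neg
    exact ((ContinuousLinearMap.smulRightL ℝ V (G →L[ℝ] V)
      (LinearMap.toContinuousLinearMap (b.coord i))).continuous).comp_continuousOn (hβ i)
  · set x := φ.symm y with hx
    have hxe : x ∈ e.baseSet := hy.2
    have hφsd : MDifferentiableAt 𝓘(ℝ, G) (𝓡 n) φ.symm y :=
      (hφs.contMDiffAt (φ.open_target.mem_nhds hy.1)).mdifferentiableAt one_ne_zero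
    let f : M → V := fun z ↦ (e ⟨z, σ z⟩).2
    have hf : MDifferentiableAt (𝓡 n) 𝓘(ℝ, V) f x :=
      (e.mdifferentiableAt_section_iff (𝓡 n) σ hxe).1 hσ
    have hr : readSection φ e σ = f ∘ φ.symm := rfl
    let D : G →L[ℝ] V := (mvfderiv (𝓡 n) f x).comp (mfderiv 𝓘(ℝ, G) (𝓡 n) φ.symm y)
    have hrd : HasFDerivAt (readSection φ e σ) D y :=
      (hf.hasMFDerivAt.comp y hφsd.hasMFDerivAt).hasFDerivAt
    refine ⟨hrd.differentiableAt, ?_⟩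
    have hfi : ∀ i, MDifferentiableAt (𝓡 n) 𝓘(ℝ, ℝ) (fun z ↦ b.coord i (f z)) x := fun i ↦
      (LinearMap.toContinuousLinearMap (b.coord i)).mdifferentiableAt.comp x hf
    have hdfi : ∀ i v, mvfderiv (𝓡 n) (fun z ↦ b.coord i (f z)) x v
        = b.coord i (mvfderiv (𝓡 n) f x v) := by
      intro i v
      have h1 := ((LinearMap.toContinuousLinearMap (b.coord i)).hasFDerivAt (x := f x)).hasMFDerivAt
      have h2 := (h1.comp x hf.hasMFDerivAt).mfderiv
      exact congrArg (fun L : TangentSpace (𝓡 n) x →L[ℝ] ℝ ↦ L v) h2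
    have hσs : ∀ z ∈ e.baseSet, σ z = ∑ i, b.coord i (f z) • s i z := by
      intro z hz
      have h1 := e.symmL_continuousLinearMapAt (R := ℝ) hz (σ z)
      rw [Trivialization.continuousLinearMapAt_apply_of_mem ℝ e hz] at h1
      change e.symmL ℝ z (f z) = σ z at h1
      rw [← h1]
      conv_lhs => rw [← b.sum_repr (f z), map_sum]
      simp only [map_smul]
      rfl
    have hcovσ : cov σ x = ∑ i, (b.coord i (f x) • cov (s i) x
        + (mvfderiv (𝓡 n) (fun z ↦ b.coord i (f z)) x).smulRight (s i x)) := by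
      rw [← cov_sum_smul cov Finset.univ hfi fun i ↦ hsd i x hxe]
      refine cov.isCovariantDerivativeOnUniv.congr_of_eventuallyEq hσ
        (MDifferentiableAt.sum_section fun j _ ↦ (hfi j).smul_section (hsd j x hxe))
        Filter.univ_mem ?_
      filter_upwards [e.open_baseSet.mem_nhds hxe] with z hz
      exact hσs z hz
    have key : ∀ w : G, e.continuousLinearMapAt ℝ x (cov σ x (mfderiv 𝓘(ℝ, G) (𝓡 n) φ.symm y w))
        = fderiv ℝ (readSection φ e σ) y w - B y (readSection φ e σ y) w := by
      intro w
      rw [hrd.fderiv, hcovσ]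
      have h1 : e.continuousLinearMapAt ℝ x ∘ (fun i ↦ s i x) = b := by
        funext i
        exact e.continuousLinearMapAt_symmL hxe (b i)
      have h2 : ∀ i, e.continuousLinearMapAt ℝ x (s i x) = b i := fun i ↦ congrFun h1 i
      have h3 : D w
          = ∑ i, b.coord i (mvfderiv (𝓡 n) f x (mfderiv 𝓘(ℝ, G) (𝓡 n) φ.symm y w)) • b i :=
        (b.sum_repr _).symm
      have h4 : B y (readSection φ e σ y) w = -∑ i, b.coord i (f x) • β i y w := by
        have h5 : B y = -∑ i, (LinearMap.toContinuousLinearMap (b.coord i)).smulRight (β i y) := rfl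
        rw [h5, neg_apply, neg_apply, sum_apply, sum_apply]
        rfl
      rw [h3, h4, sub_neg_eq_add]
      simp only [sum_apply, add_apply, smul_apply, map_sum, map_add, map_smul, hdfi, h2,
        ContinuousLinearMap.smulRight_apply, Finset.sum_add_distrib]
      rw [add_comm]
      rfl
    -- all tangent vectors at `x` come from the chart, so `key` determines `cov σ x`
    have hsurj : Function.Surjective (mfderiv 𝓘(ℝ, G) (𝓡 n) φ.symm y) :=
      OpenPartialHomeomorph.MDifferentiable.mfderiv_surjective (e := φ.symm)
        ⟨hφs.mdifferentiableOn one_ne_zero, hφ.mdifferentiableOn one_ne_zero⟩ hy.1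
    constructor
    · intro h0
      ext w
      have := key w
      rw [h0] at this
      simp only [zero_apply, map_zero] at this
      exact (sub_eq_zero.1 this.symm)
    · intro h0
      ext v
      obtain ⟨w, rfl⟩ := hsurj v
      have := key w
      rw [h0, sub_self] at this
      rw [← e.symmL_continuousLinearMapAt (R := ℝ) hxe (cov σ x _), this, map_zero]
      rfl

end LocalForm

end ParallelExt

/-! ### Local extension of parallel sections -/

namespace ParallelExt

section Extension

open Filter

theorem exists_eventually_norm_le_of_continuousAt {X W : Type*} [TopologicalSpace X]
    [NormedAddCommGroup W] {f : X → W} {x : X} (hf : ContinuousAt f x) :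
    ∃ C, ∀ᶠ y in 𝓝 x, ‖f y‖ ≤ C :=
  ⟨‖f x‖ + 1, (hf.norm.eventually (gt_mem_nhds (lt_add_one _))).mono fun _ h ↦ le_of_lt h⟩

theorem contDiffOn_one_of_continuousOn_fderiv {G V : Type*} [NormedAddCommGroup G]
    [NormedSpace ℝ G] [NormedAddCommGroup V] [NormedSpace ℝ V] {O : Set G} (hO : IsOpen O)
    {g : G → V} (hg : DifferentiableOn ℝ g O) (hg' : ContinuousOn (fderiv ℝ g) O) :
    ContDiffOn ℝ 1 g O := by
  have h := contDiffOn_succ_iff_fderiv_of_isOpen (𝕜 := ℝ) (n := 0) (f := g) hO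
  rw [zero_add] at h
  exact h.2 ⟨hg, by simp, contDiffOn_zero.2 hg'⟩

variable {n : ℕ} {M : Type u} [TopologicalSpace M] [ChartedSpace (EuclideanSpace ℝ (Fin n)) M]
  {V : Type v} [NormedAddCommGroup V] [NormedSpace ℝ V]
  {E : M → Type v} [TopologicalSpace (TotalSpace V E)]
  [∀ x, AddCommGroup (E x)] [∀ x, Module ℝ (E x)] [∀ x, TopologicalSpace (E x)]
  [∀ x, IsTopologicalAddGroup (E x)] [∀ x, ContinuousSMul ℝ (E x)]
  [FiberBundle V E]

/-- Near `q`, the section `σ`, given off `F`, agrees off `F` with a parallel section. -/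
def ExtendsNear (cov : CovariantDerivative (𝓡 n) V E) (F : Set M) (σ : (x : M) → E x)
    (q : M) : Prop :=
  ∃ N : Set M, IsOpen N ∧ q ∈ N ∧ ∃ τ : (x : M) → E x, IsParallelOn cov τ N ∧
    ∀ x ∈ N, x ∉ F → τ x = σ x

theorem extendsNear_of_notMem {cov : CovariantDerivative (𝓡 n) V E} {F : Set M}
    (hF : IsClosed F) {σ : (x : M) → E x} (hσ : IsParallelOn cov σ Fᶜ) {q : M} (hq : q ∉ F) :
    ExtendsNear cov F σ q :=
  ⟨Fᶜ, hF.isOpen_compl, hq, σ, hσ, fun _ _ _ ↦ rfl⟩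

variable [VectorBundle ℝ V E] [ContMDiffVectorBundle 1 V E (𝓡 n)]

/-- A parallel section is continuous when read in a trivialization. -/
theorem IsParallelOn.continuousAt_snd {cov : CovariantDerivative (𝓡 n) V E}
    {σ : (x : M) → E x} {N : Set M} (hσ : IsParallelOn cov σ N) (hN : IsOpen N) {q : M}
    (hq : q ∈ N) (p : M) (hqp : q ∈ (trivializationAt V E p).baseSet) :
    ContinuousAt (fun x ↦ (trivializationAt V E p ⟨x, σ x⟩).2) q :=
  (((trivializationAt V E p).contMDiffAt_section_iff hqp).1
    (hσ.1.contMDiffAt (hN.mem_nhds hq))).continuousAt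

/-- A section that is locally extendable at all points of a closed set `F` with dense complement
extends: the local extensions agree by density. -/
theorem exists_isParallelOn_of_extendsNear {cov : CovariantDerivative (𝓡 n) V E} {F : Set M}
    (hFd : Dense Fᶜ) {σ : (x : M) → E x} (h : ∀ q, ExtendsNear cov F σ q) :
    ∃ τ : (x : M) → E x, IsParallelOn cov τ univ ∧ ∀ x ∈ Fᶜ, τ x = σ x := by
  choose N hN hqN τ hτ hτσ using h
  have heq : ∀ q, ∀ x ∈ N q, τ x x = τ q x := by
    intro q x hx
    let e := trivializationAt V E x
    have hxe : x ∈ e.baseSet := mem_baseSet_trivializationAt V E x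
    have := mem_closure_iff_nhdsWithin_neBot.1 (hFd x)
    have h1 := ((hτ x).continuousAt_snd (hN x) (hqN x) x hxe).tendsto.mono_left
      (nhdsWithin_le_nhds (s := Fᶜ))
    have h2 := ((hτ q).continuousAt_snd (hN q) hx x hxe).tendsto.mono_left
      (nhdsWithin_le_nhds (s := Fᶜ))
    have h3 := tendsto_nhds_unique_of_eventuallyEq h1 h2 (by
      filter_upwards [self_mem_nhdsWithin, mem_nhdsWithin_of_mem_nhds ((hN x).mem_nhds (hqN x)),
        mem_nhdsWithin_of_mem_nhds ((hN q).mem_nhds hx)] with y hyF hyx hyq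
      rw [hτσ x y hyx hyF, hτσ q y hyq hyF])
    change (e ⟨x, τ x x⟩).2 = (e ⟨x, τ q x⟩).2 at h3
    rw [← e.symmL_continuousLinearMapAt (R := ℝ) hxe (τ x x),
      ← e.symmL_continuousLinearMapAt (R := ℝ) hxe (τ q x),
      Trivialization.continuousLinearMapAt_apply_of_mem ℝ e hxe,
      Trivialization.continuousLinearMapAt_apply_of_mem ℝ e hxe, h3]
  refine ⟨fun x ↦ τ x x, ⟨fun q _ ↦ ?_, fun q _ ↦ ?_⟩, fun x hx ↦ hτσ x x (hqN x) hx⟩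
  · refine (((hτ q).1.contMDiffAt ((hN q).mem_nhds (hqN q))).congr_of_eventuallyEq
      ?_).contMDiffWithinAt
    filter_upwards [(hN q).mem_nhds (hqN q)] with x hx
    rw [heq q x hx]
  · have hd := ((hτ q).1.contMDiffAt ((hN q).mem_nhds (hqN q))).mdifferentiableAt one_ne_zero
    rw [← (hτ q).2 q (hqN q)]
    refine cov.isCovariantDerivativeOnUniv.congr_of_eventuallyEq (hd.congr_of_eventuallyEq ?_) hd
      univ_mem ?_
    · filter_upwards [(hN q).mem_nhds (hqN q)] with x hx
      rw [heq q x hx]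
    · filter_upwards [(hN q).mem_nhds (hqN q)] with x hx
      exact heq q x hx

variable [FiniteDimensional ℝ V] [IsManifold (𝓡 n) 1 M]
  {G : Type*} [NormedAddCommGroup G] [NormedSpace ℝ G] [FiniteDimensional ℝ G]

set_option synthInstance.maxHeartbeats 100000 in
/-- Around a point, in a chart and a trivialization, the parallel sections are the solutions of an
equation `Dg = B g` on a ball, with `B` continuous and bounded. -/
theorem exists_local_equation (cov : CovariantDerivative (𝓡 n) V E)
    (hcov : MapsSections 1 0 cov) (φ : OpenPartialHomeomorph M G)
    (hφ : ContMDiffOn (𝓡 n) 𝓘(ℝ, G) 1 φ φ.source)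
    (hφs : ContMDiffOn 𝓘(ℝ, G) (𝓡 n) 1 φ.symm φ.target) {p : M} (hp : p ∈ φ.source) :
    ∃ (B : G → V →L[ℝ] G →L[ℝ] V) (C r : ℝ), 0 < r ∧ Metric.ball (φ p) r ⊆ φ.target ∧
      (∀ y ∈ Metric.ball (φ p) r, φ.symm y ∈ (trivializationAt V E p).baseSet) ∧
      ContinuousOn B (Metric.ball (φ p) r) ∧ (∀ y ∈ Metric.ball (φ p) r, ‖B y‖ ≤ C) ∧
      (∀ (σ : (x : M) → E x) (N : Set M), IsOpen N → IsParallelOn cov σ N →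
        ∀ y ∈ Metric.ball (φ p) r, φ.symm y ∈ N →
          HasFDerivAt (readSection φ (trivializationAt V E p) σ)
            (B y (readSection φ (trivializationAt V E p) σ y)) y) ∧
      ∀ g : G → V, (∀ y ∈ Metric.ball (φ p) r, HasFDerivAt g (B y (g y)) y) →
        IsParallelOn cov (fun x ↦ (trivializationAt V E p).symmL ℝ x (g (φ x)))
          (φ.source ∩ φ ⁻¹' Metric.ball (φ p) r) := by
  set e := trivializationAt V E p with he
  obtain ⟨B, hB, hσ⟩ := exists_coordinate_form cov hcov φ hφ hφs e
  have hT : IsOpen (φ.target ∩ φ.symm ⁻¹' e.baseSet) := φ.symm.isOpen_inter_preimage e.open_baseSet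
  have hpT : φ p ∈ φ.target ∩ φ.symm ⁻¹' e.baseSet := by
    refine ⟨φ.map_source hp, ?_⟩
    rw [mem_preimage, φ.left_inv hp]
    exact mem_baseSet_trivializationAt V E p
  obtain ⟨C, hC⟩ := exists_eventually_norm_le_of_continuousAt (W := V →L[ℝ] G →L[ℝ] V)
    (hB.continuousAt (hT.mem_nhds hpT))
  obtain ⟨r, hr, hrT⟩ := Metric.eventually_nhds_iff_ball.1 (hC.and (hT.mem_nhds hpT))
  have hO : IsOpen (Metric.ball (φ p) r) := Metric.isOpen_ball
  have hOT : Metric.ball (φ p) r ⊆ φ.target ∩ φ.symm ⁻¹' e.baseSet := fun y hy ↦ (hrT y hy).2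
  refine ⟨B, C, r, hr, fun y hy ↦ (hOT hy).1, fun y hy ↦ (hOT hy).2, hB.mono hOT,
    fun y hy ↦ (hrT y hy).1, ?_, ?_⟩
  · intro σ N hN hpar y hy hyN
    obtain ⟨h1, h2⟩ := hσ σ y (hOT hy)
      ((hpar.1.contMDiffAt (hN.mem_nhds hyN)).mdifferentiableAt one_ne_zero)
    rw [← h2.1 (hpar.2 _ hyN)]
    exact h1.hasFDerivAt
  · intro g hg
    set O := Metric.ball (φ p) r with hOdef
    have hopen : IsOpen (φ.source ∩ φ ⁻¹' O) := φ.isOpen_inter_preimage hO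
    have hbase : φ.source ∩ φ ⁻¹' O ⊆ e.baseSet := fun x hx ↦ by
      have := (hOT hx.2).2
      rwa [mem_preimage, φ.left_inv hx.1] at this
    have hread : ∀ x ∈ e.baseSet, (e ⟨x, e.symmL ℝ x (g (φ x))⟩).2 = g (φ x) := by
      intro x hx
      rw [← Trivialization.continuousLinearMapAt_apply_of_mem ℝ e hx,
        e.continuousLinearMapAt_symmL hx]
    have hgC : ContDiffOn ℝ 1 g O := by
      have hgd : DifferentiableOn ℝ g O := fun y hy ↦
        (hg y hy).differentiableAt.differentiableWithinAt
      refine contDiffOn_one_of_continuousOn_fderiv hO hgd ?_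
      exact ((hB.mono hOT).clm_apply hgd.continuousOn).congr fun y hy ↦ (hg y hy).fderiv
    have hC : ContMDiffOn (𝓡 n) ((𝓡 n).prod 𝓘(ℝ, V)) 1
        (fun x ↦ TotalSpace.mk' V x (e.symmL ℝ x (g (φ x)))) (φ.source ∩ φ ⁻¹' O) := by
      rw [e.contMDiffOn_section_iff hopen hbase]
      have h1 : ContMDiffOn (𝓡 n) 𝓘(ℝ, V) 1 (g ∘ φ) (φ.source ∩ φ ⁻¹' O) :=
        hgC.contMDiffOn.comp (hφ.mono inter_subset_left) fun x hx ↦ hx.2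
      exact h1.congr fun x hx ↦ hread x (hbase hx)
    refine ⟨hC, fun x hx ↦ ?_⟩
    obtain ⟨y, hy, rfl⟩ : ∃ y ∈ φ.target, φ.symm y = x :=
      ⟨φ x, φ.map_source hx.1, φ.left_inv hx.1⟩
    have hyO : y ∈ O := by
      have := hx.2
      rwa [mem_preimage, φ.right_inv hy] at this
    refine ((hσ _ y (hOT hyO) ((hC.contMDiffAt (hopen.mem_nhds hx)).mdifferentiableAt
      one_ne_zero)).2).2 ?_
    have hev : readSection φ e (fun x ↦ e.symmL ℝ x (g (φ x))) =ᶠ[𝓝 y] g := by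
      filter_upwards [hO.mem_nhds hyO] with z hz
      have h1 := hread (φ.symm z) (hOT hz).2
      rw [φ.right_inv (hOT hz).1] at h1
      simp only [readSection]
      rwa [φ.right_inv (hOT hz).1]
    rw [hev.fderiv_eq, hev.eq_of_nhds]
    exact (hg y hyO).fderiv

/-- If `F` is contained in a hypersurface `{ℓ ∘ φ = 0}` in a chart `φ` at `p`, extendability at one
point of the hypersurface close to `p` implies extendability at `p`. -/
theorem exists_extendsNear_of_extendsNear {cov : CovariantDerivative (𝓡 n) V E}
    (hcov : MapsSections 1 0 cov) {F : Set M} (hF : IsClosed F) {σ : (x : M) → E x}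
    (hσ : IsParallelOn cov σ Fᶜ) (φ : OpenPartialHomeomorph M G)
    (hφ : ContMDiffOn (𝓡 n) 𝓘(ℝ, G) 1 φ φ.source)
    (hφs : ContMDiffOn 𝓘(ℝ, G) (𝓡 n) 1 φ.symm φ.target) {p : M} (hp : p ∈ φ.source)
    {ℓ : G →L[ℝ] ℝ} (hℓ : ℓ ≠ 0) (hFℓ : ∀ x ∈ φ.source, x ∈ F → ℓ (φ x) = 0) :
    ∃ O : Set M, IsOpen O ∧ p ∈ O ∧
      ∀ q ∈ O, q ∈ φ.source → ℓ (φ q) = 0 → ExtendsNear cov F σ q → ExtendsNear cov F σ p := by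
  obtain ⟨B, C, r, hr, hTt, hTe, hB, hC, hread, hsec⟩ :=
    exists_local_equation cov hcov φ hφ hφs hp
  set e := trivializationAt V E p with he
  set O : Set G := Metric.ball (φ p) r with hO
  refine ⟨φ.source ∩ φ ⁻¹' O, φ.isOpen_inter_preimage Metric.isOpen_ball,
    ⟨hp, Metric.mem_ball_self hr⟩, ?_⟩
  rintro q ⟨hqs, hqO⟩ - hq0 ⟨N, hN, hqN, τ, hτ, hτσ⟩
  have hqz : φ.symm (φ q) = q := φ.left_inv hqs
  have hnotF : ∀ y ∈ O, ℓ y ≠ 0 → φ.symm y ∉ F := by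
    intro y hy hy0 hyF
    have hyt := hTt hy
    have := hFℓ _ (φ.map_target hyt) hyF
    rw [φ.right_inv hyt] at this
    exact hy0 this
  have hN' : ∀ᶠ y in 𝓝 (φ q), φ.symm y ∈ N := by
    have h1 := φ.continuousAt_symm (φ.map_source hqs)
    refine h1.eventually (hN.mem_nhds ?_)
    rwa [hqz]
  obtain ⟨g, hg, hgσ⟩ := exists_extension_across_hyperplane (convex_ball _ _) Metric.isOpen_ball
    Metric.isBounded_ball hB hC hℓ
    (g := readSection φ e σ)
    (fun y hy hy0 ↦ hread σ Fᶜ hF.isOpen_compl hσ y hy (hnotF y hy hy0))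
    (z := φ q) hqO hq0 (h := readSection φ e τ)
    (hread τ N hN hτ _ hqO (by rwa [hqz])).continuousAt
    (by
      filter_upwards [hN', Metric.isOpen_ball.mem_nhds hqO] with y hyN hyO hy0
      simp only [readSection]
      rw [hτσ _ hyN (hnotF y hyO hy0)])
  refine ⟨φ.source ∩ φ ⁻¹' O, φ.isOpen_inter_preimage Metric.isOpen_ball,
    ⟨hp, Metric.mem_ball_self hr⟩, _, hsec g hg,
    ?_⟩
  rintro x ⟨hxs, hxO⟩ hxF
  have hxz : φ.symm (φ x) = x := φ.left_inv hxs
  have hxe : x ∈ e.baseSet := by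
    have := hTe _ hxO
    rwa [hxz] at this
  suffices h : g (φ x) = (e ⟨x, σ x⟩).2 by
    simp only [h]
    rw [← Trivialization.continuousLinearMapAt_apply_of_mem ℝ e hxe,
      e.symmL_continuousLinearMapAt hxe]
  have hreadx : readSection φ e σ (φ x) = (e ⟨x, σ x⟩).2 := by
    simp only [readSection]
    rw [hxz]
  rw [← hreadx]
  by_cases hx0 : ℓ (φ x) = 0
  · -- off `F` but on the hypersurface, the two sections agree by continuity
    have hcl := mem_closure_inter_pos Metric.isOpen_ball hℓ hxO hx0.ge
    have := mem_closure_iff_nhdsWithin_neBot.1 hcl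
    have hc1 := (hg _ hxO).continuousAt.tendsto.mono_left
      (nhdsWithin_le_nhds (s := O ∩ {y | 0 < ℓ y}))
    have hc2 := (hread σ Fᶜ hF.isOpen_compl hσ _ hxO
      (by rwa [hxz])).continuousAt.tendsto.mono_left
      (nhdsWithin_le_nhds (s := O ∩ {y | 0 < ℓ y}))
    refine tendsto_nhds_unique_of_eventuallyEq hc1 hc2 ?_
    filter_upwards [self_mem_nhdsWithin] with y hy
    exact hgσ y hy.1 hy.2.ne'
  · exact hgσ _ hxO hx0

/-- On a connected manifold, a parallel section that vanishes somewhere vanishes everywhere. -/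
theorem IsParallelOn.eq_zero_of_eq_zero [PreconnectedSpace M]
    {cov : CovariantDerivative (𝓡 n) V E} (hcov : MapsSections 1 0 cov) {τ : (x : M) → E x}
    (hτ : IsParallelOn cov τ univ) {p : M} (hp : τ p = 0) (q : M) : τ q = 0 := by
  have hzero : ∀ (p x : M), x ∈ (trivializationAt V E p).baseSet →
      (τ x = 0 ↔ (trivializationAt V E p ⟨x, τ x⟩).2 = 0) := by
    intro p x hx
    rw [← Trivialization.continuousLinearMapAt_apply_of_mem ℝ _ hx]
    constructor
    · intro h
      rw [h, map_zero]
    · intro h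
      rw [← (trivializationAt V E p).symmL_continuousLinearMapAt (R := ℝ) hx (τ x), h, map_zero]
  have hcl : IsClopen {x | τ x = 0} := by
    constructor
    · rw [← isOpen_compl_iff, isOpen_iff_mem_nhds]
      intro x hx
      have hxe := mem_baseSet_trivializationAt V E x
      have h1 := hτ.continuousAt_snd isOpen_univ (mem_univ x) x hxe
      filter_upwards [h1.eventually_ne fun h ↦ hx ((hzero x x hxe).2 h),
        (trivializationAt V E x).open_baseSet.mem_nhds hxe] with y hy hye hy0
      exact hy ((hzero x y hye).1 hy0)
    · rw [isOpen_iff_mem_nhds]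
      intro x hx
      let φ := chartAt (EuclideanSpace ℝ (Fin n)) x
      have hxs : x ∈ φ.source := mem_chart_source _ x
      obtain ⟨B, C, r, hr, hTt, hTe, hB, hC, hread, -⟩ := exists_local_equation cov hcov φ
        contMDiffOn_chart contMDiffOn_chart_symm hxs
      filter_upwards [φ.open_source.mem_nhds hxs,
        (φ.continuousAt hxs).preimage_mem_nhds (Metric.ball_mem_nhds (φ x) hr)] with z hzs hz
      have hze : z ∈ (trivializationAt V E x).baseSet := by
        have := hTe _ hz
        rwa [φ.left_inv hzs] at this
      rw [hzero x z hze]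
      have h2 := norm_le_mul_exp_of_hasFDerivWithinAt (convex_ball (φ x) r)
        hC (g := readSection φ (trivializationAt V E x) τ)
        (fun y hy ↦ (hread τ univ isOpen_univ hτ y hy (mem_univ _)).hasFDerivWithinAt)
        (Metric.mem_ball_self hr) hz
      have h3 : readSection φ (trivializationAt V E x) τ (φ x) = 0 := by
        simp only [readSection]
        rw [φ.left_inv hxs]
        exact (hzero x x (mem_baseSet_trivializationAt V E x)).1 hx
      rw [h3, norm_zero, zero_mul, norm_le_zero_iff] at h2
      simp only [readSection] at h2
      rwa [φ.left_inv hzs] at h2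
  have := hcl.eq_univ ⟨p, hp⟩
  exact (this ▸ mem_univ q : q ∈ {x | τ x = 0})

end Extension

end ParallelExt

/-! ### Connections on trivial bundles -/

namespace ParallelExt

section TrivialBundle

open Filter

variable {n : ℕ} {M : Type u} [TopologicalSpace M] [ChartedSpace (EuclideanSpace ℝ (Fin n)) M]
  {W : Type v} [NormedAddCommGroup W] [NormedSpace ℝ W]

theorem mdifferentiableAt_trivial_iff {σ : M → W} {x : M} :
    MDifferentiableAt (𝓡 n) ((𝓡 n).prod 𝓘(ℝ, W))
      (fun y ↦ TotalSpace.mk' W (E := Bundle.Trivial M W) y (σ y)) x ↔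
    MDifferentiableAt (𝓡 n) 𝓘(ℝ, W) σ x := by
  rw [mdifferentiableAt_section]
  rfl

theorem contMDiffOn_trivial_iff {m : ℕ∞ω} {σ : M → W} {U : Set M} :
    ContMDiffOn (𝓡 n) ((𝓡 n).prod 𝓘(ℝ, W)) m
      (fun y ↦ TotalSpace.mk' W (E := Bundle.Trivial M W) y (σ y)) U ↔
    ContMDiffOn (𝓡 n) 𝓘(ℝ, W) m σ U :=
  forall₂_congr fun x _ ↦ by
    rw [contMDiffWithinAt_section]
    rfl

variable (W) in
/-- The connection `σ ↦ dσ + a db ⊗ σ` on the trivial bundle `M × W`. -/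
noncomputable def twistedConnection (a b : M → ℝ) :
    CovariantDerivative (𝓡 n) W (Bundle.Trivial M W) where
  toFun σ x := mvfderiv (𝓡 n) (F := W) σ x + a x • (mvfderiv (𝓡 n) b x).smulRight (σ x : W)
  isCovariantDerivativeOnUniv :=
    { add := by
        intro σ σ' x hσ hσ' _
        rw [mdifferentiableAt_trivial_iff] at hσ hσ'
        have h := mvfderiv_add hσ hσ'
        ext v
        change mvfderiv (𝓡 n) (F := W) (σ + σ') x v
            + a x • mvfderiv (𝓡 n) b x v • ((σ x : W) + σ' x)
          = (mvfderiv (𝓡 n) (F := W) σ x v + a x • mvfderiv (𝓡 n) b x v • (σ x : W))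
            + (mvfderiv (𝓡 n) (F := W) σ' x v + a x • mvfderiv (𝓡 n) b x v • (σ' x : W))
        have h' : mvfderiv (𝓡 n) (F := W) (σ + σ') x v
          = mvfderiv (𝓡 n) (F := W) σ x v + mvfderiv (𝓡 n) (F := W) σ' x v := by
          rw [h]; rfl
        rw [h']
        module
      leibniz := by
        intro σ g x hσ hg _
        rw [mdifferentiableAt_trivial_iff] at hσ
        have h := mvfderiv_smul hg hσ
        ext v
        change mvfderiv (𝓡 n) (F := W) (g • σ) x v + a x • mvfderiv (𝓡 n) b x v • (g x • (σ x : W))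
          = g x • (mvfderiv (𝓡 n) (F := W) σ x v + a x • mvfderiv (𝓡 n) b x v • (σ x : W))
            + mvfderiv (𝓡 n) g x v • (σ x : W)
        have h' : mvfderiv (𝓡 n) (F := W) (g • σ) x v
          = g x • mvfderiv (𝓡 n) (F := W) σ x v + mvfderiv (𝓡 n) g x v • (σ x : W) := by
          rw [h]; rfl
        rw [h']
        module }

theorem twistedConnection_apply (a b : M → ℝ) (σ : M → W) (x : M) :
    (twistedConnection W a b : CovariantDerivative (𝓡 n) W (Bundle.Trivial M W)) σ x =
      mvfderiv (𝓡 n) σ x + a x • (mvfderiv (𝓡 n) b x).smulRight (σ x) := rfl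

theorem isParallelOn_twistedConnection {a b : M → ℝ} {σ : M → W} {U : Set M}
    (hσ : ∀ x ∈ U, ∀ᶠ y in 𝓝 x, σ y = σ x) (ha : ∀ x ∈ U, a x = 0) :
    IsParallelOn (twistedConnection W a b :
      CovariantDerivative (𝓡 n) W (Bundle.Trivial M W)) σ U := by
  constructor
  · rw [contMDiffOn_trivial_iff (σ := σ)]
    exact fun x hx ↦ (contMDiffAt_const.congr_of_eventuallyEq (hσ x hx)).contMDiffWithinAt
  · intro x hx
    have h : mfderiv (𝓡 n) 𝓘(ℝ, W) σ x = 0 := by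
      rw [Filter.EventuallyEq.mfderiv_eq (hσ x hx), mfderiv_const]
    rw [twistedConnection_apply, ha x hx, zero_smul, add_zero, mvfderiv, h]
    exact ContinuousLinearMap.comp_zero _

/-- A function of class `C^k` of the coordinates at `p` agrees near `p` with a `C^k` function on
`M` that vanishes off a given neighbourhood of `p`. -/
theorem exists_contMDiff_eq_chart [T2Space M] {k : ℕ∞} [IsManifold (𝓡 n) k M] (p : M) {O : Set M}
    (hO : O ∈ 𝓝 p) {h : EuclideanSpace ℝ (Fin n) → ℝ} (hh : ContDiff ℝ k h) :
    ∃ a : M → ℝ, ContMDiff (𝓡 n) 𝓘(ℝ, ℝ) k a ∧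
      (∀ᶠ x in 𝓝 p, a x = h (chartAt (EuclideanSpace ℝ (Fin n)) p x)) ∧ ∀ x ∉ O, a x = 0 := by
  classical
  set φ := chartAt (EuclideanSpace ℝ (Fin n)) p with hφ
  have hp : p ∈ φ.source := mem_chart_source _ p
  have hnhds : φ.target ∩ φ.symm ⁻¹' O ∈ 𝓝 (φ p) := by
    refine inter_mem (φ.open_target.mem_nhds (φ.map_source hp)) ?_
    refine (φ.continuousAt_symm (φ.map_source hp)).preimage_mem_nhds ?_
    rwa [φ.left_inv hp]
  obtain ⟨r, hr, hrO⟩ := Metric.nhds_basis_closedBall.mem_iff.1 hnhds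
  let f : ContDiffBump (φ p) := ⟨r / 2, r, half_pos hr, half_lt_self hr⟩
  set K : Set M := φ.symm '' Metric.closedBall (φ p) r with hK
  have hKs : K ⊆ φ.source := by
    rintro _ ⟨y, hy, rfl⟩
    exact φ.map_target (hrO hy).1
  have hKc : IsClosed K := ((isCompact_closedBall _ _).image_of_continuousOn
    (φ.continuousOn_symm.mono fun y hy ↦ (hrO hy).1)).isClosed
  set a : M → ℝ := fun x ↦ if x ∈ φ.source then f (φ x) * h (φ x) else 0 with ha
  have haK : ∀ x ∉ K, a x = 0 := by
    intro x hx
    by_cases hxs : x ∈ φ.source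
    · have : φ x ∉ Metric.closedBall (φ p) r := fun hy ↦ hx ⟨_, hy, φ.left_inv hxs⟩
      have h0 : f (φ x) = 0 := f.zero_of_le_dist (not_le.1 this).le
      simp [ha, hxs, h0]
    · simp [ha, hxs]
  refine ⟨a, fun x ↦ ?_, ?_, fun x hx ↦ haK x ?_⟩
  · by_cases hx : x ∈ φ.source
    · have h1 : ContMDiffAt 𝓘(ℝ, EuclideanSpace ℝ (Fin n)) 𝓘(ℝ, ℝ) k
          (fun y ↦ f y * h y) (φ x) := (f.contDiff.mul hh).contDiffAt.contMDiffAt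
      have h2 : ContMDiffAt (𝓡 n) (𝓡 n) k φ x :=
        contMDiffOn_chart.contMDiffAt (φ.open_source.mem_nhds hx)
      refine (h1.comp x h2).congr_of_eventuallyEq ?_
      filter_upwards [φ.open_source.mem_nhds hx] with y hy
      simp [ha, hy]
    · refine (contMDiffAt_const (c := (0 : ℝ))).congr_of_eventuallyEq ?_
      filter_upwards [hKc.isOpen_compl.mem_nhds fun h ↦ hx (hKs h)] with y hy
      exact haK y hy
  · filter_upwards [φ.open_source.mem_nhds hp,
      (φ.continuousAt hp).preimage_mem_nhds (Metric.ball_mem_nhds _ (half_pos hr))] with x hx hxr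
    have h1 : f (φ x) = 1 := f.one_of_mem_closedBall (Metric.ball_subset_closedBall hxr)
    simp [ha, hx, h1]
  · rintro ⟨y, hy, rfl⟩
    exact hx (hrO hy).2

variable [IsManifold (𝓡 n) 1 M]

/-- The differential of a `C^l` function is a `C^m` section of `Hom(TM, W)` if `m + 1 ≤ l`. -/
theorem contMDiffOn_mvfderiv {l m : ℕ∞} (hml : m + 1 ≤ l) [IsManifold (𝓡 n) l M]
    {U : Set M} (hU : IsOpen U) {f : M → W}
    (hf : ContMDiffOn (𝓡 n) 𝓘(ℝ, W) l f U) :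
    ContMDiffOn (𝓡 n) ((𝓡 n).prod 𝓘(ℝ, EuclideanSpace ℝ (Fin n) →L[ℝ] W)) m
      (fun x ↦ TotalSpace.mk' (EuclideanSpace ℝ (Fin n) →L[ℝ] W)
        (E := fun x ↦ TangentSpace (𝓡 n) x →L[ℝ] Bundle.Trivial M W x) x
        (mvfderiv (𝓡 n) f x)) U := by
  intro x hx
  refine ContMDiffAt.contMDiffWithinAt ?_
  rw [contMDiffAt_hom_bundle]
  refine ⟨contMDiffAt_id, ?_⟩
  have hml' : (m : ℕ∞ω) + 1 ≤ l := by exact_mod_cast hml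
  have h := (hf.contMDiffAt (hU.mem_nhds hx)).mfderiv_const hml'
  refine h.congr_of_eventuallyEq (Eventually.of_forall fun y ↦ ?_)
  ext v
  simp only [inTangentCoordinates, ContinuousLinearMap.inCoordinates,
    TangentBundle.continuousLinearMapAt_model_space, id]
  -- the tangent space of `W` and the fibre of `M × W` are both trivialized by the identity
  have h2 := Bundle.Trivial.continuousLinearMapAt_trivialization ℝ M W y
  change (Bundle.Trivial.trivialization M W).continuousLinearMapAt ℝ y _ = _
  rw [h2]
  rfl

/-- The connection `d + a db` is of class `C^m` if `a` and `b` are of class `C^l`, `m + 1 ≤ l`. -/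
theorem mapsSections_twistedConnection {l m : ℕ∞} (hml : m + 1 ≤ l) [IsManifold (𝓡 n) l M]
    {a b : M → ℝ} (ha : ContMDiff (𝓡 n) 𝓘(ℝ, ℝ) l a) (hb : ContMDiff (𝓡 n) 𝓘(ℝ, ℝ) l b) :
    MapsSections l m (twistedConnection W a b :
      CovariantDerivative (𝓡 n) W (Bundle.Trivial M W)) := by
  intro U σ hU hσ
  rw [contMDiffOn_trivial_iff (σ := σ)] at hσ
  -- `db ⊗ σ = d(b σ) - b dσ` is a combination of differentials of functions
  have hm : (m : ℕ∞ω) ≤ l := by exact_mod_cast le_self_add.trans hml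
  have hl : (l : ℕ∞ω) ≠ 0 := by
    have : l ≠ 0 := fun h ↦ by simp [h] at hml
    exact_mod_cast this
  have h1 := contMDiffOn_mvfderiv hml hU hσ
  have h2 := contMDiffOn_mvfderiv hml hU (hb.contMDiffOn.smul hσ)
  have h3 := h2.sub_section ((hb.contMDiffOn.of_le hm).smul_section h1)
  refine (h1.add_section ((ha.contMDiffOn.of_le hm).smul_section h3)).congr fun x hx ↦ ?_
  have h4 := mvfderiv_smul ((hb x).mdifferentiableAt hl)
    ((hσ.contMDiffAt (hU.mem_nhds hx)).mdifferentiableAt hl)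
  congr 1
  change _ = mvfderiv (𝓡 n) (F := W) σ x + a x • (mvfderiv (𝓡 n) (F := W) (b • σ) x
    - b x • mvfderiv (𝓡 n) (F := W) σ x)
  rw [h4, add_sub_cancel_left]
  rfl

theorem isConnectionOfClass_twistedConnection {k : ℕ∞} (hk : 1 ≤ k) [IsManifold (𝓡 n) k M]
    {a b : M → ℝ} (ha : ContMDiff (𝓡 n) 𝓘(ℝ, ℝ) k a) (hb : ContMDiff (𝓡 n) 𝓘(ℝ, ℝ) k b) :
    IsConnectionOfClass k (k - 1) (twistedConnection W a b :
      CovariantDerivative (𝓡 n) W (Bundle.Trivial M W)) := by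
  have h := (tsub_add_cancel_of_le hk).le
  refine ⟨mapsSections_twistedConnection (l := 1) (by simp) ?_ ?_, h,
    mapsSections_twistedConnection h ha hb⟩
  · exact ha.of_le (by exact_mod_cast hk)
  · exact hb.of_le (by exact_mod_cast hk)

/-- If `Fᶜ` is the disjoint union of two nonempty open sets, the section that is `0` on one and `w`
on the other does not extend to a parallel section for the trivial connection. -/
theorem isPreconnected_compl_of_negligibleFor [PreconnectedSpace M] [FiniteDimensional ℝ W]
    {w : W} (hw : w ≠ 0) {F : Set M} (hF : IsClosed F)
    (h : NegligibleFor F (twistedConnection W 0 0 :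
      CovariantDerivative (𝓡 n) W (Bundle.Trivial M W))) : IsPreconnected Fᶜ := by
  classical
  rintro u v hu hv huv ⟨x, hxF, hxu⟩ ⟨y, hyF, hyv⟩
  by_contra hne
  have hdis : ∀ z ∈ Fᶜ, z ∈ u → z ∉ v := fun z hz hzu hzv ↦ hne ⟨z, hz, hzu, hzv⟩
  obtain ⟨τ, hτ, hτσ⟩ := h (fun z ↦ if z ∈ u then w else 0) (by
    refine isParallelOn_twistedConnection (σ := fun z ↦ if z ∈ u then w else 0)
      (fun z hz ↦ ?_) fun _ _ ↦ rfl
    rcases huv hz with hzu | hzv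
    · filter_upwards [hu.mem_nhds hzu] with t ht
      simp [ht, hzu]
    · filter_upwards [hv.mem_nhds hzv, hF.isOpen_compl.mem_nhds hz] with t ht htF
      have h1 : t ∉ u := fun htu ↦ hdis t htF htu ht
      have h2 : z ∉ u := fun hzu ↦ hdis z hz hzu hzv
      simp [h1, h2])
  have h0 : τ y = 0 := by
    rw [hτσ y hyF]
    exact if_neg fun hyu ↦ hdis y hyF hyu hyv
  have h1 := hτ.eq_zero_of_eq_zero (mapsSections_twistedConnection (by simp) contMDiff_const
    contMDiff_const) h0 x
  rw [hτσ x hxF] at h1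
  exact hw ((if_pos hxu).symm.trans h1)

/-- The equation `Dg = - y₁ g dy₀` is not integrable: its solutions do not depend on `y₁`, so
neither does `∂g / ∂y₀ = - y₁ g`, whence `g = 0`. -/
theorem eq_zero_of_hasFDerivAt_neg_smul {g : EuclideanSpace ℝ (Fin n) → W} {i j : Fin n}
    (hij : i ≠ j) {c : EuclideanSpace ℝ (Fin n)} {r : ℝ} (hr : 0 < r)
    (hg : ∀ y ∈ Metric.ball c r, HasFDerivAt g
      (-(y j • (EuclideanSpace.proj (𝕜 := ℝ) i).smulRight (g y))) y) : g c = 0 := by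
  set e : EuclideanSpace ℝ (Fin n) := EuclideanSpace.single j (r / 2) with he
  have hen : ‖e‖ = r / 2 := by simp [he, abs_of_pos hr]
  have hei : e i = 0 := by simp [he, hij]
  have hej : e j = r / 2 := by simp [he]
  have hinv : ∀ y ∈ Metric.ball c (r / 2), g (y + e) = g y := by
    intro y hy
    have hmem : ∀ t ∈ Icc (0 : ℝ) 1, y + t • e ∈ Metric.ball c r := by
      intro t ht
      rw [mem_ball_iff_norm] at hy ⊢
      calc ‖y + t • e - c‖ = ‖(y - c) + t • e‖ := by congr 1; abel
        _ ≤ ‖y - c‖ + ‖t • e‖ := norm_add_le _ _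
        _ < r / 2 + r / 2 := by
          refine add_lt_add_of_lt_of_le hy ?_
          rw [norm_smul, hen, Real.norm_of_nonneg ht.1]
          nlinarith [ht.2]
        _ = r := add_halves r
    have hd : ∀ t ∈ Icc (0 : ℝ) 1, HasDerivAt (fun t : ℝ ↦ g (y + t • e)) 0 t := by
      intro t ht
      have h1 : HasDerivAt (fun t : ℝ ↦ y + t • e) e t := by
        simpa using ((hasDerivAt_id t).smul_const e).const_add y
      have h2 := (hg _ (hmem t ht)).comp_hasDerivAt t h1
      simpa [hei, Function.comp_def] using h2
    have := constant_of_has_deriv_right_zero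
      (fun t ht ↦ (hd t ht).continuousAt.continuousWithinAt)
      (fun t ht ↦ (hd t (Ico_subset_Icc_self ht)).hasDerivWithinAt) 1 (right_mem_Icc.2 zero_le_one)
    simpa using this
  have hce : c + e ∈ Metric.ball c r := by
    rw [mem_ball_iff_norm, add_sub_cancel_left, hen]
    exact half_lt_self hr
  have h1 : HasFDerivAt (fun y ↦ g (y + e))
      (-((c + e) j • (EuclideanSpace.proj (𝕜 := ℝ) i).smulRight (g (c + e)))) c :=
    (hasFDerivAt_comp_add_right e).2 (hg _ hce)
  have h2 := (h1.congr_of_eventuallyEq (f₁ := g) (by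
    filter_upwards [Metric.ball_mem_nhds c (half_pos hr)] with y hy
    exact (hinv y hy).symm)).unique (hg c (Metric.mem_ball_self hr))
  have h3 := congrArg (fun L ↦ L (EuclideanSpace.single i (1 : ℝ))) h2
  have h4 : ((c j + r / 2) • g c : W) = c j • g c := by
    simpa [hej, hinv c (Metric.mem_ball_self (half_pos hr))] using h3
  rw [add_smul, add_eq_left, smul_eq_zero] at h4
  exact h4.resolve_left (half_pos hr).ne'

/-- In the chart `φ`, the parallel sections of `d + a db` solve `Dg = - a g db`. -/
theorem hasFDerivAt_of_twistedConnection_eq_zero {a b : M → ℝ} {τ : M → W}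
    (hτ : IsParallelOn (twistedConnection W a b :
      CovariantDerivative (𝓡 n) W (Bundle.Trivial M W)) τ univ)
    (hb : ContMDiff (𝓡 n) 𝓘(ℝ, ℝ) 1 b) {p : M} {y : EuclideanSpace ℝ (Fin n)}
    (hy : y ∈ (chartAt (EuclideanSpace ℝ (Fin n)) p).target)
    {b' : EuclideanSpace ℝ (Fin n) →L[ℝ] ℝ}
    (hb' : HasFDerivAt (b ∘ (chartAt (EuclideanSpace ℝ (Fin n)) p).symm) b' y) :
    HasFDerivAt (τ ∘ (chartAt (EuclideanSpace ℝ (Fin n)) p).symm)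
      (-(a ((chartAt (EuclideanSpace ℝ (Fin n)) p).symm y) •
        b'.smulRight (τ ((chartAt (EuclideanSpace ℝ (Fin n)) p).symm y)))) y := by
  set φ := chartAt (EuclideanSpace ℝ (Fin n)) p with hφ
  have hs : MDifferentiableAt (𝓡 n) (𝓡 n) φ.symm y :=
    ((contMDiffOn_chart_symm (n := 1)).contMDiffAt (φ.open_target.mem_nhds hy)).mdifferentiableAt
      one_ne_zero
  have hτ1 := hτ.1
  rw [contMDiffOn_trivial_iff (σ := τ), contMDiffOn_univ] at hτ1
  have h1 := ((hτ1 (φ.symm y)).mdifferentiableAt one_ne_zero).hasMFDerivAt.comp y hs.hasMFDerivAt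
  have h2 := ((hb (φ.symm y)).mdifferentiableAt one_ne_zero).hasMFDerivAt.comp y hs.hasMFDerivAt
  let L : EuclideanSpace ℝ (Fin n) →L[ℝ] W := (mfderiv (𝓡 n) 𝓘(ℝ, W) τ (φ.symm y)).comp
    (mfderiv (𝓡 n) (𝓡 n) φ.symm y)
  let L' : EuclideanSpace ℝ (Fin n) →L[ℝ] ℝ := (mfderiv (𝓡 n) 𝓘(ℝ, ℝ) b (φ.symm y)).comp
    (mfderiv (𝓡 n) (𝓡 n) φ.symm y)
  have h1' : HasFDerivAt (τ ∘ φ.symm) L y := h1.hasFDerivAt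
  have h2' : HasFDerivAt (b ∘ φ.symm) L' y := h2.hasFDerivAt
  have h3 := h2'.unique hb'
  have h4 := hτ.2 (φ.symm y) (mem_univ _)
  rw [twistedConnection_apply] at h4
  refine h1'.congr_fderiv ?_
  ext v
  have h5 := congrArg (fun L : TangentSpace (𝓡 n) (φ.symm y) →L[ℝ] W ↦
    L (mfderiv (𝓡 n) (𝓡 n) φ.symm y v)) h4
  have h6 := congrArg (fun L : EuclideanSpace ℝ (Fin n) →L[ℝ] ℝ ↦ L v) h3
  change mvfderiv (𝓡 n) τ (φ.symm y) _ + a (φ.symm y) •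
    (mvfderiv (𝓡 n) b (φ.symm y) (mfderiv (𝓡 n) (𝓡 n) φ.symm y v)) • τ (φ.symm y) = 0 at h5
  change mvfderiv (𝓡 n) b (φ.symm y) (mfderiv (𝓡 n) (𝓡 n) φ.symm y v) = b' v at h6
  change mvfderiv (𝓡 n) τ (φ.symm y) (mfderiv (𝓡 n) (𝓡 n) φ.symm y v) =
    -(a (φ.symm y) • b' v • τ (φ.symm y))
  rw [h6] at h5
  exact eq_neg_of_add_eq_zero_left h5

/-- If `F` has interior points, a connection with nonvanishing curvature inside `F` and trivial off
`F` has parallel sections off `F` that do not extend. -/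
theorem interior_eq_empty_of_negligibleFor [PreconnectedSpace M] [T2Space M]
    [FiniteDimensional ℝ W] (hn : 2 ≤ n) {k : ℕ∞} (hk : 1 ≤ k) [IsManifold (𝓡 n) k M]
    {w : W} (hw : w ≠ 0) {F : Set M} (hFM : F ≠ univ)
    (h : ∀ cov : CovariantDerivative (𝓡 n) W (Bundle.Trivial M W),
      IsConnectionOfClass k (k - 1) cov → NegligibleFor F cov) : interior F = ∅ := by
  by_contra hne
  obtain ⟨p, hp⟩ := nonempty_iff_ne_empty.2 hne
  obtain ⟨q, hq⟩ := (ne_univ_iff_exists_notMem F).1 hFM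
  set φ := chartAt (EuclideanSpace ℝ (Fin n)) p with hφ
  -- near `p`, `a` and `b` are two coordinates; off `F`, `a` vanishes and constants are parallel
  let i : Fin n := ⟨0, by omega⟩
  let j : Fin n := ⟨1, by omega⟩
  have hij : i ≠ j := by simp [i, j]
  have hF : F ∈ 𝓝 p := mem_interior_iff_mem_nhds.1 hp
  obtain ⟨a, ha, hap, haF⟩ := exists_contMDiff_eq_chart (k := k) p hF
    (h := fun y ↦ y j) (EuclideanSpace.proj (𝕜 := ℝ) j).contDiff
  obtain ⟨b, hb, hbp, -⟩ := exists_contMDiff_eq_chart (k := k) p hF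
    (h := fun y ↦ y i) (EuclideanSpace.proj (𝕜 := ℝ) i).contDiff
  have hcov := isConnectionOfClass_twistedConnection (W := W) hk ha hb
  obtain ⟨τ, hτ, hτσ⟩ := h _ hcov (fun _ ↦ w)
    (isParallelOn_twistedConnection (σ := fun _ ↦ w) (fun _ _ ↦ Eventually.of_forall fun _ ↦ rfl)
      fun x hx ↦ haF x hx)
  have hb1 : ContMDiff (𝓡 n) 𝓘(ℝ, ℝ) 1 b := hb.of_le (by exact_mod_cast hk)
  have hps : p ∈ φ.source := mem_chart_source _ p
  have hev : ∀ᶠ y in 𝓝 (φ p), (a (φ.symm y) = y j ∧ b (φ.symm y) = y i) ∧ y ∈ φ.target := by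
    have h1 := φ.continuousAt_symm (φ.map_source hps)
    rw [ContinuousAt, φ.left_inv hps] at h1
    filter_upwards [h1.eventually (hap.and hbp), φ.open_target.mem_nhds (φ.map_source hps)]
      with y hy hyt
    rwa [← hφ, φ.right_inv hyt, and_iff_left hyt] at *
  obtain ⟨r, hr, hrb⟩ := Metric.eventually_nhds_iff_ball.1 hev
  have h0 : (τ ∘ φ.symm) (φ p) = 0 := by
    refine eq_zero_of_hasFDerivAt_neg_smul hij hr fun y hy ↦ ?_
    have h1 : HasFDerivAt (b ∘ φ.symm) (EuclideanSpace.proj (𝕜 := ℝ) i) y := by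
      refine (EuclideanSpace.proj (𝕜 := ℝ) i).hasFDerivAt.congr_of_eventuallyEq ?_
      filter_upwards [Metric.isOpen_ball.mem_nhds hy] with z hz
      exact (hrb z hz).1.2
    have h2 := hasFDerivAt_of_twistedConnection_eq_zero hτ hb1 (hrb y hy).2 h1
    rwa [← hφ, (hrb y hy).1.1] at h2
  rw [Function.comp_apply, φ.left_inv hps] at h0
  have h1 := hτ.eq_zero_of_eq_zero hcov.1 h0 q
  rw [hτσ q hq] at h1
  exact hw h1

/-- A closed set that is negligible for all connections on a trivial bundle of positive rank is
nowhere dense and does not separate `M`. -/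
theorem isNowhereDense_and_isConnected_compl [PreconnectedSpace M] [T2Space M]
    [FiniteDimensional ℝ W] (hn : 2 ≤ n) {k : ℕ∞} (hk : 1 ≤ k) [IsManifold (𝓡 n) k M]
    {w : W} (hw : w ≠ 0) {F : Set M} (hF : IsClosed F) (hFM : F ≠ univ)
    (h : ∀ cov : CovariantDerivative (𝓡 n) W (Bundle.Trivial M W),
      IsConnectionOfClass k (k - 1) cov → NegligibleFor F cov) :
    IsNowhereDense F ∧ IsConnected Fᶜ :=
  ⟨hF.isNowhereDense_iff.2 (interior_eq_empty_of_negligibleFor hn hk hw hFM h),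
    nonempty_compl.2 hFM, isPreconnected_compl_of_negligibleFor hw hF
      (h _ (isConnectionOfClass_twistedConnection hk contMDiff_const contMDiff_const))⟩

end TrivialBundle

end ParallelExt

/-! ### Half-spaces and the invariance of the boundary -/

namespace ParallelExt

section HalfSpace

open Filter

theorem isClosed_halfSpace : ∀ d : ℕ, IsClosed (halfSpace d)
  | 0 => isClosed_univ
  | d + 1 => isClosed_le continuous_const (EuclideanSpace.proj (𝕜 := ℝ) (Fin.last d)).continuous

theorem convex_halfSpace : ∀ d : ℕ, Convex ℝ (halfSpace d)
  | 0 => convex_univ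
  | d + 1 => convex_halfSpace_ge (EuclideanSpace.proj (𝕜 := ℝ) (Fin.last d)).isLinear 0

theorem setOf_last_pos_subset_interior_halfSpace (d : ℕ) :
    {x : EuclideanSpace ℝ (Fin (d + 1)) | 0 < x (Fin.last d)} ⊆ interior (halfSpace (d + 1)) :=
  interior_maximal (fun x hx ↦ (le_of_lt hx : 0 ≤ x (Fin.last d)))
    (isOpen_lt continuous_const (EuclideanSpace.proj (𝕜 := ℝ) (Fin.last d)).continuous)

theorem last_eq_zero_of_notMem_interior {d : ℕ} {x : EuclideanSpace ℝ (Fin (d + 1))}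
    (hx : x ∈ halfSpace (d + 1)) (hx' : x ∉ interior (halfSpace (d + 1))) : x (Fin.last d) = 0 :=
  le_antisymm (not_lt.1 fun h ↦ hx' (setOf_last_pos_subset_interior_halfSpace d h)) hx

/-- Some line through a boundary point of a half-space leaves it on one side. -/
theorem exists_forall_neg_add_smul_notMem_halfSpace {d : ℕ} {x : EuclideanSpace ℝ (Fin d)}
    (hx : x ∈ halfSpace d) (hx' : x ∉ interior (halfSpace d)) :
    ∃ v : EuclideanSpace ℝ (Fin d), ∀ t < (0 : ℝ), x + t • v ∉ halfSpace d := by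
  match d with
  | 0 =>
    refine absurd ?_ hx'
    simp [halfSpace]
  | d + 1 =>
    refine ⟨EuclideanSpace.single (Fin.last d) 1, fun t ht h ↦ ?_⟩
    have h0 := last_eq_zero_of_notMem_interior hx hx'
    have h1 : 0 ≤ (x + t • EuclideanSpace.single (Fin.last d) (1 : ℝ)) (Fin.last d) := h
    simp [h0] at h1
    exact absurd h1 (not_le.2 ht)

theorem exists_forall_pos_add_smul_mem_interior_halfSpace {d : ℕ} {x : EuclideanSpace ℝ (Fin d)}
    (hx : x ∈ halfSpace d) :
    ∃ v : EuclideanSpace ℝ (Fin d), ∀ t > (0 : ℝ), x + t • v ∈ interior (halfSpace d) := by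
  match d with
  | 0 => exact ⟨0, fun t _ ↦ by simp [halfSpace]⟩
  | d + 1 =>
    refine ⟨EuclideanSpace.single (Fin.last d) 1, fun t ht ↦
      setOf_last_pos_subset_interior_halfSpace d ?_⟩
    have h1 : 0 ≤ x (Fin.last d) := hx
    simp only [mem_ofPred_eq, PiLp.add_apply, PiLp.smul_apply, PiLp.single_apply, if_pos,
      smul_eq_mul, mul_one]
    exact add_pos_of_nonneg_of_pos h1 ht

variable {M : Type u} [TopologicalSpace M]

/-- A boundary point of a subspace `S` of `M`, in terms of maps defined on `M` and on `ℝ^d` (with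
arbitrary values off `S ∩ O` and off the half-space). -/
theorem exists_invOn_halfSpace_of_mem_boundaryPoints {S : Set M} {q : S}
    (hq : q ∈ boundaryPoints S) :
    ∃ (d : ℕ) (O : Set M) (f : M → EuclideanSpace ℝ (Fin d)) (g : EuclideanSpace ℝ (Fin d) → M),
      IsOpen O ∧ (q : M) ∈ O ∧ ContinuousOn f (S ∩ O) ∧ ContinuousOn g (halfSpace d) ∧
      MapsTo f (S ∩ O) (halfSpace d) ∧ MapsTo g (halfSpace d) (S ∩ O) ∧
      InvOn g f (S ∩ O) (halfSpace d) ∧ f q ∈ frontier (halfSpace d) := by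
  classical
  obtain ⟨d, U, hqU, ψ, hψ⟩ := hq
  obtain ⟨O, hO, hOU⟩ := isOpen_induced_iff.1 U.isOpen
  have hU : ∀ x : S, x ∈ U ↔ (x : M) ∈ O := fun x ↦ by
    rw [← SetLike.mem_coe, ← hOU, mem_preimage]
  let s : (S ∩ O : Set M) → U := fun x ↦ ⟨⟨x, x.2.1⟩, (hU _).2 x.2.2⟩
  have hs : Continuous s := by fun_prop
  let f : M → EuclideanSpace ℝ (Fin d) := fun x ↦ if h : x ∈ S ∩ O then ψ (s ⟨x, h⟩) else 0
  let g : EuclideanSpace ℝ (Fin d) → M := fun y ↦ if h : y ∈ halfSpace d then ψ.symm ⟨y, h⟩ else q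
  have hf : ∀ x (h : x ∈ S ∩ O), f x = ψ (s ⟨x, h⟩) := fun x h ↦ dif_pos h
  have hg : ∀ y (h : y ∈ halfSpace d), g y = ψ.symm ⟨y, h⟩ := fun y h ↦ dif_pos h
  have hqO : (q : M) ∈ O := (hU q).1 hqU
  refine ⟨d, O, f, g, hO, hqO, ?_, ?_, ?_, ?_, ⟨?_, ?_⟩, ?_⟩
  · rw [continuousOn_iff_continuous_domRestrict]
    have : (S ∩ O).domRestrict f = fun x ↦ (ψ (s x) : EuclideanSpace ℝ (Fin d)) :=
      funext fun x ↦ hf x x.2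
    rw [this]
    fun_prop
  · rw [continuousOn_iff_continuous_domRestrict]
    have : (halfSpace d).domRestrict g = fun y ↦ ((ψ.symm y : S) : M) := funext fun y ↦ hg y y.2
    rw [this]
    fun_prop
  · intro x hx
    rw [hf x hx]
    exact (ψ _).2
  · intro y hy
    rw [hg y hy]
    exact ⟨(ψ.symm ⟨y, hy⟩ : S).2, (hU _).1 (ψ.symm ⟨y, hy⟩).2⟩
  · intro x hx
    have h1 : f x ∈ halfSpace d := by
      rw [hf x hx]
      exact (ψ _).2
    rw [hg _ h1]
    have h2 : (⟨f x, h1⟩ : halfSpace d) = ψ (s ⟨x, hx⟩) := Subtype.ext (hf x hx)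
    rw [h2, ψ.symm_apply_apply]
  · intro y hy
    have h1 : g y ∈ S ∩ O := by
      rw [hg y hy]
      exact ⟨(ψ.symm ⟨y, hy⟩ : S).2, (hU _).1 (ψ.symm ⟨y, hy⟩).2⟩
    rw [hf _ h1]
    have h2 : s ⟨g y, h1⟩ = ψ.symm ⟨y, hy⟩ := Subtype.ext (Subtype.ext (hg y hy))
    rw [h2, ψ.apply_symm_apply]
  · rw [hf _ ⟨q.2, hqO⟩]
    exact hψ

/-- Invariance of the boundary. Push a small sphere around an interior point `q` of `S` inward in
the half-space chart: if `q` were a boundary point, then the disc that it bounds would be deformed,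
relative to the sphere, to a disc missing `q`. -/
theorem notMem_boundaryPoints_of_slice {S : Set M} {d c : ℕ}
    (φ : OpenPartialHomeomorph M (EuclideanSpace ℝ (Fin d) × EuclideanSpace ℝ (Fin c)))
    (hφ : ∀ x ∈ φ.source, x ∈ S ↔ φ x ∈ halfSpace d ×ˢ {0}) {q : S} (hq : (q : M) ∈ φ.source)
    (hint : (φ q).1 ∈ interior (halfSpace d)) : q ∉ boundaryPoints S := by
  intro hqb
  obtain ⟨d', O, f, g, hO, hqO, hf, hg, hfm, hgm, hinv, hfr⟩ :=
    exists_invOn_halfSpace_of_mem_boundaryPoints hqb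
  match d' with
  | 0 => simp [halfSpace] at hfr
  | d' + 1 =>
  have hfq0 : f q (Fin.last d') = 0 := last_eq_zero_of_notMem_interior
    ((isClosed_halfSpace _).frontier_subset hfr) hfr.2
  set x₀ := (φ q).1 with hx₀
  have hφq : φ q = (x₀, 0) := Prod.ext rfl ((hφ q hq).1 q.2).2
  -- the points sent by `g` into the domain of `φ` contain a half-ball around `f q`
  have hgq : g (f q) = q := hinv.1 ⟨q.2, hqO⟩
  obtain ⟨ε, hε, hgε⟩ : ∃ ε > 0, ∀ y ∈ Metric.ball (f q) ε ∩ halfSpace (d' + 1),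
      g y ∈ φ.source := by
    have h1 : g ⁻¹' φ.source ∈ 𝓝[halfSpace (d' + 1)] (f q) :=
      (hg _ (hfm ⟨q.2, hqO⟩)).preimage_mem_nhdsWithin (φ.open_source.mem_nhds (by rwa [hgq]))
    obtain ⟨ε, hε, h⟩ := Metric.mem_nhdsWithin_iff.1 h1
    exact ⟨ε, hε, fun y hy ↦ h hy⟩
  -- a small disc in `S` around `q`
  let ι : EuclideanSpace ℝ (Fin d) → M := fun x ↦ φ.symm (x + x₀, 0)
  have hι0 : ι 0 = q := by
    simp only [ι, zero_add, ← hφq]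
    exact φ.left_inv hq
  have hpair : Continuous fun x : EuclideanSpace ℝ (Fin d) ↦
    ((x + x₀, 0) : EuclideanSpace ℝ (Fin d) × EuclideanSpace ℝ (Fin c)) := by fun_prop
  have hmem : ∀ᶠ x in 𝓝 (0 : EuclideanSpace ℝ (Fin d)), (x + x₀, 0) ∈ φ.target ∧
      x + x₀ ∈ halfSpace d := by
    refine (hpair.continuousAt.eventually ?_).and
      ((continuous_add_const x₀).continuousAt.eventually ?_)
    · simp only [zero_add, ← hφq]
      exact φ.open_target.mem_nhds (φ.map_source hq)
    · simp only [zero_add]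
      exact mem_interior_iff_mem_nhds.1 hint
  have hιS : ∀ x, (x + x₀, 0) ∈ φ.target ∧ x + x₀ ∈ halfSpace d → ι x ∈ S := by
    rintro x ⟨h1, h2⟩
    rw [hφ _ (φ.map_target h1), φ.right_inv h1]
    exact ⟨h2, rfl⟩
  have hιc : ∀ᶠ x in 𝓝 (0 : EuclideanSpace ℝ (Fin d)), ContinuousAt ι x ∧ ι x ∈ O ∧
      ((x + x₀, 0) ∈ φ.target ∧ x + x₀ ∈ halfSpace d) := by
    have h1 : ∀ᶠ x in 𝓝 (0 : EuclideanSpace ℝ (Fin d)), ContinuousAt ι x := by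
      filter_upwards [hmem] with x hx
      exact (φ.continuousAt_symm hx.1).comp (f := fun x : EuclideanSpace ℝ (Fin d) ↦
        ((x + x₀, 0) : EuclideanSpace ℝ (Fin d) × EuclideanSpace ℝ (Fin c))) hpair.continuousAt
    refine h1.and (Eventually.and ?_ hmem)
    exact h1.self_of_nhds.eventually (by rw [hι0]; exact hO.mem_nhds hqO)
  obtain ⟨r₁, hr₁, hball⟩ := Metric.eventually_nhds_iff_ball.1 hιc
  have hιcont : ContinuousOn ι (Metric.ball 0 r₁) := fun x hx ↦
    (hball x hx).1.continuousWithinAt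
  have hιm : MapsTo ι (Metric.ball 0 r₁) (S ∩ O) := fun x hx ↦
    ⟨hιS x (hball x hx).2.2, (hball x hx).2.1⟩
  have hk : ContinuousOn (f ∘ ι) (Metric.ball 0 r₁) := hf.comp hιcont hιm
  obtain ⟨r, hr, hrr, hrε⟩ : ∃ r > 0, Metric.closedBall (0 : EuclideanSpace ℝ (Fin d)) r ⊆
      Metric.ball 0 r₁ ∧ ∀ x ∈ Metric.closedBall (0 : EuclideanSpace ℝ (Fin d)) r,
        f (ι x) ∈ Metric.ball (f q) (ε / 2) := by
    have h1 : ∀ᶠ x in 𝓝 (0 : EuclideanSpace ℝ (Fin d)), f (ι x) ∈ Metric.ball (f q) (ε / 2) := by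
      refine (hk.continuousAt (Metric.ball_mem_nhds 0 hr₁)).eventually ?_
      rw [Function.comp_apply, hι0]
      exact Metric.ball_mem_nhds _ (half_pos hε)
    obtain ⟨r, hr, h⟩ := Metric.nhds_basis_closedBall.mem_iff.1
      (h1.and (Metric.ball_mem_nhds 0 hr₁))
    exact ⟨r, hr, fun x hx ↦ (h hx).2, fun x hx ↦ (h hx).1⟩
  -- the disc, pushed away from the boundary of the half-space
  let δ : ℝ := ε / (2 * r)
  have hδ : 0 < δ := by positivity
  have hδr : r * δ = ε / 2 := by
    simp only [δ]
    field_simp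
  let e : EuclideanSpace ℝ (Fin (d' + 1)) := EuclideanSpace.single (Fin.last d') 1
  let K : EuclideanSpace ℝ (Fin d) → EuclideanSpace ℝ (Fin (d' + 1)) :=
    fun x ↦ f (ι x) + ((r - ‖x‖) * δ) • e
  have hKlast : ∀ x, K x (Fin.last d') = f (ι x) (Fin.last d') + (r - ‖x‖) * δ := fun x ↦ by
    simp [K, e]
  have hflast : ∀ x ∈ Metric.closedBall (0 : EuclideanSpace ℝ (Fin d)) r,
      0 ≤ f (ι x) (Fin.last d') := fun x hx ↦ hfm (hιm (hrr hx))
  have hnorm : ∀ x ∈ Metric.closedBall (0 : EuclideanSpace ℝ (Fin d)) r, ‖x‖ ≤ r := fun x hx ↦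
    mem_closedBall_zero_iff.1 hx
  have hKmem : ∀ x ∈ Metric.closedBall (0 : EuclideanSpace ℝ (Fin d)) r,
      K x ∈ Metric.ball (f q) ε ∩ halfSpace (d' + 1) := by
    intro x hx
    have h0 : 0 ≤ (r - ‖x‖) * δ := mul_nonneg (sub_nonneg.2 (hnorm x hx)) hδ.le
    constructor
    · have h1 := hrε x hx
      rw [mem_ball_iff_norm] at h1 ⊢
      have h2 : ‖((r - ‖x‖) * δ) • e‖ ≤ ε / 2 := by
        rw [norm_smul, Real.norm_of_nonneg h0, ← hδr]
        simp only [e, PiLp.norm_single, norm_one, mul_one]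
        gcongr
        exact sub_le_self _ (norm_nonneg _)
      calc ‖K x - f q‖ = ‖(f (ι x) - f q) + ((r - ‖x‖) * δ) • e‖ := by
            simp only [K]
            congr 1
            abel
        _ ≤ ‖f (ι x) - f q‖ + ‖((r - ‖x‖) * δ) • e‖ := norm_add_le _ _
        _ < ε := by linarith
    · change 0 ≤ K x (Fin.last d')
      rw [hKlast]
      exact add_nonneg (hflast x hx) h0
  have hKne : ∀ x ∈ Metric.closedBall (0 : EuclideanSpace ℝ (Fin d)) r, K x ≠ f q := by
    intro x hx hK
    have h1 := hKlast x
    rw [hK, hfq0] at h1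
    have h2 := hflast x hx
    have h3 : 0 ≤ (r - ‖x‖) * δ := mul_nonneg (sub_nonneg.2 (hnorm x hx)) hδ.le
    have h4 : (r - ‖x‖) * δ = 0 := by linarith
    have h5 : f (ι x) = f q := by
      simp only [K, h4, zero_smul, add_zero] at hK
      exact hK
    have h6 : ι x = q := hinv.1.injOn (hιm (hrr hx)) ⟨q.2, hqO⟩ h5
    have h7 := φ.right_inv (hball x (hrr hx)).2.2.1
    change φ (ι x) = _ at h7
    rw [h6, hφq, Prod.mk.injEq, right_eq_add] at h7
    rw [h7.1, norm_zero, sub_zero] at h4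
    exact (mul_pos hr hδ).ne' h4
  have hgK : ∀ x ∈ Metric.closedBall (0 : EuclideanSpace ℝ (Fin d)) r, g (K x) ∈ φ.source :=
    fun x hx ↦ hgε _ (hKmem x hx)
  have hKc : ContinuousOn K (Metric.closedBall 0 r) := by
    have := hk.mono hrr
    simp only [K]
    exact ContinuousOn.add this (by fun_prop)
  have hFc : ContinuousOn (fun x ↦ (φ (g (K x))).1 - x₀) (Metric.closedBall 0 r) := by
    have h1 : ContinuousOn (fun x ↦ g (K x)) (Metric.closedBall 0 r) :=
      hg.comp hKc fun x hx ↦ (hKmem x hx).2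
    have h2 : ContinuousOn (fun x ↦ φ (g (K x))) (Metric.closedBall 0 r) :=
      φ.continuousOn.comp h1 hgK
    exact (continuous_fst.comp_continuousOn h2).sub continuousOn_const
  obtain ⟨x, hx, hx0⟩ := exists_eq_zero_of_eq_id_on_sphere hr hFc (by
    intro x hx
    have hxb := Metric.sphere_subset_closedBall hx
    have hxr : ‖x‖ = r := mem_sphere_zero_iff_norm.1 hx
    have h1 : K x = f (ι x) := by simp [K, hxr]
    have h2 := φ.right_inv (hball x (hrr hxb)).2.2.1
    rw [h1, hinv.1 (hιm (hrr hxb))]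
    change (φ (φ.symm _)).1 - x₀ = x
    rw [h2, add_sub_cancel_right])
  have h1 : φ (g (K x)) = φ q := by
    rw [hφq]
    exact Prod.ext (sub_eq_zero.1 hx0)
      ((hφ _ (hgK x hx)).1 (hgm (hKmem x hx).2).1).2
  have h2 : g (K x) = q := φ.injOn (hgK x hx) hq h1
  refine hKne x hx ?_
  rw [← h2, hinv.2 (hKmem x hx).2]

end HalfSpace

end ParallelExt

/-! ### Submanifolds with boundary and their components -/

namespace ParallelExt

section Submanifold

open Filter

variable {n : ℕ} {M : Type u} [TopologicalSpace M] [ChartedSpace (EuclideanSpace ℝ (Fin n)) M]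

variable (n) in
/-- The chart `φ` of class `C^1`, with values in `ℝ^d × ℝ^c`, takes `S` to the half-space slice
`H_d × {0}`. -/
structure IsSliceChart (S : Set M) {d c : ℕ}
    (φ : OpenPartialHomeomorph M (EuclideanSpace ℝ (Fin d) × EuclideanSpace ℝ (Fin c))) :
    Prop where
  contMDiffOn : ContMDiffOn (𝓡 n)
    𝓘(ℝ, EuclideanSpace ℝ (Fin d) × EuclideanSpace ℝ (Fin c)) 1 φ φ.source
  contMDiffOn_symm : ContMDiffOn 𝓘(ℝ, EuclideanSpace ℝ (Fin d) × EuclideanSpace ℝ (Fin c)) (𝓡 n) 1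
    φ.symm φ.target
  mem_iff : ∀ x ∈ φ.source, x ∈ S ↔ φ x ∈ halfSpace d ×ˢ {0}

theorem hasCodimAt_iff_exists_isSliceChart {S : Set M} {p : M} {c : ℕ} :
    HasCodimAt n 1 S p c ↔ ∃ (d : ℕ) (φ : OpenPartialHomeomorph M
      (EuclideanSpace ℝ (Fin d) × EuclideanSpace ℝ (Fin c))),
        p ∈ φ.source ∧ IsSliceChart n S φ := by
  refine exists_congr fun d ↦ exists_congr fun φ ↦ and_congr_right fun _ ↦ ?_
  constructor
  · rintro ⟨h1, h2, h3⟩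
    refine ⟨h1, h2, fun x hx ↦ ⟨fun hxS ↦ ?_, fun hxH ↦ ?_⟩⟩
    · exact (h3 ▸ mem_image_of_mem φ ⟨hxS, hx⟩ : φ x ∈ _ ∩ φ.target).1
    · obtain ⟨y, ⟨hyS, hy⟩, hyx⟩ : φ x ∈ φ '' (S ∩ φ.source) := h3 ▸ ⟨hxH, φ.map_source hx⟩
      rwa [← φ.injOn hy hx hyx]
  · rintro ⟨h1, h2, h3⟩
    refine ⟨h1, h2, Subset.antisymm ?_ ?_⟩
    · rintro _ ⟨x, ⟨hxS, hx⟩, rfl⟩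
      exact ⟨(h3 x hx).1 hxS, φ.map_source hx⟩
    · rintro y ⟨hyH, hy⟩
      refine ⟨φ.symm y, ⟨(h3 _ (φ.map_target hy)).2 ?_, φ.map_target hy⟩, φ.right_inv hy⟩
      rwa [φ.right_inv hy]

/-- A slice chart of `F` is, after restriction to `O`, one of any set with the same trace
on `O`. -/
theorem IsSliceChart.restrOpen {F Z O : Set M} {d c : ℕ}
    {φ : OpenPartialHomeomorph M (EuclideanSpace ℝ (Fin d) × EuclideanSpace ℝ (Fin c))}
    (h : IsSliceChart n F φ) (hO : IsOpen O) (hFZ : ∀ x ∈ O, x ∈ F ↔ x ∈ Z) :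
    IsSliceChart n Z (φ.restrOpen O hO) where
  contMDiffOn := h.contMDiffOn.mono fun x hx ↦ by
    rw [φ.restrOpen_source] at hx
    exact hx.1
  contMDiffOn_symm := h.contMDiffOn_symm.mono fun y hy ↦ by
    have := (φ.restrOpen O hO).map_target hy
    rw [φ.restrOpen_source] at this
    have h1 : (φ.restrOpen O hO) ((φ.restrOpen O hO).symm y) = y := (φ.restrOpen O hO).right_inv hy
    rw [← h1]
    exact φ.map_source this.1
  mem_iff := fun x hx ↦ by
    rw [φ.restrOpen_source] at hx
    rw [← hFZ x hx.2]
    exact h.mem_iff x hx.1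

section Chart

variable {G : Type*} [NormedAddCommGroup G] [NormedSpace ℝ G]

/-- Close to `p`, moving on a line in a chart. -/
theorem eventually_symm_add_smul (φ : OpenPartialHomeomorph M G) {p : M} (hp : p ∈ φ.source)
    {O : Set M} (hO : O ∈ 𝓝 p) (v : G) :
    ∀ᶠ t : ℝ in 𝓝 0, ∃ x ∈ O, x ∈ φ.source ∧ φ x = φ p + t • v := by
  have h1 : Tendsto (fun t : ℝ ↦ φ p + t • v) (𝓝 0) (𝓝 (φ p)) := by
    have : Continuous fun t : ℝ ↦ φ p + t • v := by fun_prop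
    simpa using this.tendsto 0
  have h2 : ∀ᶠ y in 𝓝 (φ p), φ.symm y ∈ O ∧ y ∈ φ.target := by
    refine Eventually.and ?_ (φ.open_target.mem_nhds (φ.map_source hp))
    refine (φ.continuousAt_symm (φ.map_source hp)).eventually ?_
    rwa [φ.left_inv hp]
  filter_upwards [h1.eventually h2] with t ht
  exact ⟨_, ht.1, φ.map_target ht.2, φ.right_inv ht.2⟩

theorem exists_neg_symm_add_smul (φ : OpenPartialHomeomorph M G) {p : M} (hp : p ∈ φ.source)
    {O : Set M} (hO : O ∈ 𝓝 p) (v : G) :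
    ∃ t < (0 : ℝ), ∃ x ∈ O, x ∈ φ.source ∧ φ x = φ p + t • v := by
  obtain ⟨t, h, ht⟩ := (((eventually_symm_add_smul φ hp hO v).filter_mono
    (nhdsWithin_le_nhds (s := Iio 0))).and self_mem_nhdsWithin).exists
  exact ⟨t, ht, h⟩

end Chart

variable {d c : ℕ}
  {φ : OpenPartialHomeomorph M (EuclideanSpace ℝ (Fin d) × EuclideanSpace ℝ (Fin c))}

/-- At a point of codimension `0`, the set `F` contains points of its interior. -/
theorem IsSliceChart.interior_nonempty {F : Set M}
    {φ : OpenPartialHomeomorph M (EuclideanSpace ℝ (Fin d) × EuclideanSpace ℝ (Fin 0))}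
    (h : IsSliceChart n F φ) {p : M} (hp : p ∈ φ.source) (hpF : p ∈ F) :
    (interior F).Nonempty := by
  obtain ⟨v, hv⟩ := exists_forall_pos_add_smul_mem_interior_halfSpace ((h.mem_iff p hp).1 hpF).1
  obtain ⟨t, ht, x, -, hx, hxt⟩ := exists_neg_symm_add_smul φ hp univ_mem (-v, 0)
  have hopen : IsOpen (φ.source ∩ φ ⁻¹' (interior (halfSpace d) ×ˢ univ)) :=
    φ.isOpen_inter_preimage (isOpen_interior.prod isOpen_univ)
  refine ⟨x, mem_interior.2 ⟨_, fun y hy ↦ ?_, hopen, hx, ?_, mem_univ _⟩⟩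
  · exact (h.mem_iff y hy.1).2 ⟨interior_subset hy.2.1, Subsingleton.elim _ _⟩
  · rw [hxt]
    simpa using hv (-t) (neg_pos.2 ht)

/-- At a point of positive codimension, `F` has no interior. -/
theorem IsSliceChart.mem_closure_compl {F : Set M} (h : IsSliceChart n F φ) (hc : 1 ≤ c) {p : M}
    (hp : p ∈ φ.source) (hpF : p ∈ F) : p ∈ closure Fᶜ := by
  rw [mem_closure_iff_nhds]
  intro O hO
  obtain ⟨t, ht, x, hxO, hx, hxt⟩ := exists_neg_symm_add_smul φ hp hO
    (0, EuclideanSpace.single ⟨0, hc⟩ (1 : ℝ))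
  refine ⟨x, hxO, fun hxF ↦ ht.ne ?_⟩
  have h1 : (φ x).2 = 0 := ((h.mem_iff x hx).1 hxF).2
  have h2 : (φ p).2 = 0 := ((h.mem_iff p hp).1 hpF).2
  rw [hxt, Prod.snd_add, h2, zero_add] at h1
  simpa using congrArg (fun y : EuclideanSpace ℝ (Fin c) ↦ y ⟨0, hc⟩) h1

/-- Submanifolds are locally connected. -/
theorem IsSliceChart.exists_isOpen_connectedComponentIn {F : Set M} (h : IsSliceChart n F φ)
    {p q : M} (hq : q ∈ φ.source) (hqF : q ∈ connectedComponentIn F p) :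
    ∃ O, IsOpen O ∧ q ∈ O ∧ ∀ x ∈ O, x ∈ F ↔ x ∈ connectedComponentIn F p := by
  obtain ⟨r, hr, hrt⟩ := Metric.isOpen_iff.1 φ.open_target (φ q) (φ.map_source hq)
  refine ⟨φ.source ∩ φ ⁻¹' Metric.ball (φ q) r, φ.isOpen_inter_preimage Metric.isOpen_ball,
    ⟨hq, Metric.mem_ball_self hr⟩, fun x hx ↦ ⟨fun hxF ↦ ?_,
      fun hxZ ↦ connectedComponentIn_subset F p hxZ⟩⟩
  set A := (halfSpace d ×ˢ {0}) ∩ Metric.ball (φ q) r with hA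
  have hAc : IsPreconnected A :=
    (((convex_halfSpace d).prod (convex_singleton 0)).inter (convex_ball _ _)).isPreconnected
  have hAi : IsPreconnected (φ.symm '' A) :=
    hAc.image _ (φ.continuousOn_symm.mono fun y hy ↦ hrt hy.2)
  have hAF : φ.symm '' A ⊆ F := by
    rintro _ ⟨y, hy, rfl⟩
    rw [h.mem_iff _ (φ.map_target (hrt hy.2)), φ.right_inv (hrt hy.2)]
    exact hy.1
  have hqA : q ∈ φ.symm '' A := ⟨φ q, ⟨(h.mem_iff q hq).1 (connectedComponentIn_subset F p hqF),
    Metric.mem_ball_self hr⟩, φ.left_inv hq⟩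
  have hxA : x ∈ φ.symm '' A := ⟨φ x, ⟨(h.mem_iff x hx.1).1 hxF, hx.2⟩, φ.left_inv hx.1⟩
  rw [connectedComponentIn_eq hqF]
  exact hAi.subset_connectedComponentIn hqA hAF hxA

theorem hasCodimAt_connectedComponentIn {F : Set M} {p q : M} {c : ℕ} (h : HasCodimAt n 1 F q c)
    (hq : q ∈ connectedComponentIn F p) : HasCodimAt n 1 (connectedComponentIn F p) q c := by
  obtain ⟨d, φ, hqs, hφ⟩ := hasCodimAt_iff_exists_isSliceChart.1 h
  obtain ⟨O, hO, hqO, hOF⟩ := hφ.exists_isOpen_connectedComponentIn hqs hq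
  refine hasCodimAt_iff_exists_isSliceChart.2 ⟨d, φ.restrOpen O hO, ?_, hφ.restrOpen hO hOF⟩
  rw [φ.restrOpen_source]
  exact ⟨hqs, hqO⟩

theorem codim_le {S : Set M} {p : M} (hp : p ∈ S) {c : ℕ} (h : HasCodimAt n 1 S p c) :
    codim n 1 S ≤ c :=
  iInf₂_le_of_le p hp (iInf₂_le c h)

theorem one_le_codim_iff {S : Set M} :
    1 ≤ codim n 1 S ↔ ∀ p ∈ S, ∀ c, HasCodimAt n 1 S p c → 1 ≤ c := by
  simp only [codim, le_iInf_iff, Nat.one_le_cast]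

theorem one_le_codim_of_interior_eq_empty {S : Set M} (h : interior S = ∅) : 1 ≤ codim n 1 S := by
  refine one_le_codim_iff.2 fun p hp c hc ↦ Nat.one_le_iff_ne_zero.2 ?_
  rintro rfl
  obtain ⟨d, φ, hps, hφ⟩ := hasCodimAt_iff_exists_isSliceChart.1 hc
  exact (hφ.interior_nonempty hps hp).ne_empty h

theorem dense_compl_of_one_le_codim {F : Set M} (hF : IsSubmanifoldWithBoundary n 1 F)
    (h : 1 ≤ codim n 1 F) : Dense Fᶜ := by
  intro p
  by_cases hp : p ∈ F
  · obtain ⟨c, hc⟩ := hF p hp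
    obtain ⟨d, φ, hps, hφ⟩ := hasCodimAt_iff_exists_isSliceChart.1 hc
    exact hφ.mem_closure_compl (one_le_codim_iff.1 h p hp c hc) hps hp
  · exact subset_closure hp

theorem isClosed_connectedComponentIn {X : Type*} [TopologicalSpace X] {F : Set X}
    (hF : IsClosed F) (p : X) : IsClosed (connectedComponentIn F p) := by
  by_cases hp : p ∈ F
  · rw [connectedComponentIn_eq_image hp]
    exact hF.isClosedEmbedding_subtypeVal.isClosedMap _ isClosed_connectedComponent
  · rw [connectedComponentIn_eq_empty hp]
    exact isClosed_empty

/-- A boundaryless component of codimension `1` would dissect `M`, hence also `Fᶜ`, which is dense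
in the complement of the component. -/
theorem boundaryPoints_nonempty_of_isConnected_compl (hM : DissectedByHypersurfaces n M)
    {F : Set M} (hF : IsClosed F) (hFs : IsSubmanifoldWithBoundary n 1 F)
    (hFd : Dense Fᶜ) (hFc : IsPreconnected Fᶜ) {p : M} (hp : p ∈ F)
    (hcodim : codim n 1 (connectedComponentIn F p) = 1) :
    boundaryPoints (connectedComponentIn F p) ≠ ∅ := fun hb ↦
  hM (connectedComponentIn F p) (isClosed_connectedComponentIn hF p)
    (isConnected_connectedComponentIn_iff.2 hp)
    (fun q hq ↦ (hFs q (connectedComponentIn_subset F p hq)).imp fun _ hc ↦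
      hasCodimAt_connectedComponentIn hc hq) hb hcodim
    (hFc.subset_closure (compl_subset_compl.2 (connectedComponentIn_subset F p))
      (hFd.closure_eq ▸ subset_univ _))

section Sections

variable [IsManifold (𝓡 n) 1 M]
  {V : Type v} [NormedAddCommGroup V] [NormedSpace ℝ V] [FiniteDimensional ℝ V]
  {E : M → Type v} [TopologicalSpace (TotalSpace V E)]
  [∀ x, AddCommGroup (E x)] [∀ x, Module ℝ (E x)] [∀ x, TopologicalSpace (E x)]
  [∀ x, IsTopologicalAddGroup (E x)] [∀ x, ContinuousSMul ℝ (E x)]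
  [FiberBundle V E] [VectorBundle ℝ V E] [ContMDiffVectorBundle 1 V E (𝓡 n)]
  {cov : CovariantDerivative (𝓡 n) V E} {F : Set M} {σ : (x : M) → E x}

/-- In positive codimension, extendability spreads along the hyperplane `y₀ = 0` that contains the
slice `H_d × {0}`. -/
theorem IsSliceChart.exists_extendsNear_of_extendsNear (h : IsSliceChart n F φ) (hc : 1 ≤ c)
    (hcov : MapsSections 1 0 cov) (hF : IsClosed F) (hσ : IsParallelOn cov σ Fᶜ) {p : M}
    (hp : p ∈ φ.source) : ∃ O : Set M, IsOpen O ∧ p ∈ O ∧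
      ∀ q ∈ O, q ∈ φ.source → (φ q).2 ⟨0, hc⟩ = 0 → ExtendsNear cov F σ q →
        ExtendsNear cov F σ p := by
  let ℓ : EuclideanSpace ℝ (Fin d) × EuclideanSpace ℝ (Fin c) →L[ℝ] ℝ :=
    (EuclideanSpace.proj (𝕜 := ℝ) ⟨0, hc⟩).comp (ContinuousLinearMap.snd ℝ _ _)
  have hℓ : ℓ ≠ 0 := fun h0 ↦ by
    have h1 := congrArg (fun L : EuclideanSpace ℝ (Fin d) × EuclideanSpace ℝ (Fin c) →L[ℝ] ℝ ↦
      L (0, EuclideanSpace.single ⟨0, hc⟩ 1)) h0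
    simp [ℓ] at h1
  refine ParallelExt.exists_extendsNear_of_extendsNear hcov hF hσ φ h.contMDiffOn
    h.contMDiffOn_symm hp hℓ fun x hx hxF ↦ ?_
  have h1 : (φ x).2 = 0 := ((h.mem_iff x hx).1 hxF).2
  simp [ℓ, h1]

/-- Near a point where `F` has codimension at least `2`, or a boundary point of `F`, the hyperplane
`y₀ = 0` has points off `F`. -/
theorem IsSliceChart.extendsNear (h : IsSliceChart n F φ) (hc : 1 ≤ c)
    (hcov : MapsSections 1 0 cov) (hF : IsClosed F) (hσ : IsParallelOn cov σ Fᶜ) {p : M}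
    (hp : p ∈ φ.source) (hpF : p ∈ F) (hcb : 2 ≤ c ∨ (φ p).1 ∉ interior (halfSpace d)) :
    ExtendsNear cov F σ p := by
  obtain ⟨O, hO, hpO, hext⟩ := h.exists_extendsNear_of_extendsNear hc hcov hF hσ hp
  have hp1 : (φ p).1 ∈ halfSpace d := ((h.mem_iff p hp).1 hpF).1
  have hp2 : (φ p).2 = 0 := ((h.mem_iff p hp).1 hpF).2
  suffices h' : ∃ q ∈ O, q ∈ φ.source ∧ (φ q).2 ⟨0, hc⟩ = 0 ∧ q ∉ F by
    obtain ⟨q, hqO, hqs, hq0, hqF⟩ := h'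
    exact hext q hqO hqs hq0 (extendsNear_of_notMem hF hσ hqF)
  rcases hcb with hc2 | hb
  · obtain ⟨t, ht, x, hxO, hx, hxt⟩ := exists_neg_symm_add_smul φ hp (hO.mem_nhds hpO)
      (0, EuclideanSpace.single ⟨1, hc2⟩ (1 : ℝ))
    refine ⟨x, hxO, hx, by simp [hxt, hp2], fun hxF ↦ ht.ne ?_⟩
    have h1 : (φ x).2 = 0 := ((h.mem_iff x hx).1 hxF).2
    rw [hxt, Prod.snd_add, hp2, zero_add] at h1
    simpa using congrArg (fun y : EuclideanSpace ℝ (Fin c) ↦ y ⟨1, hc2⟩) h1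
  · obtain ⟨v, hv⟩ := exists_forall_neg_add_smul_notMem_halfSpace hp1 hb
    obtain ⟨t, ht, x, hxO, hx, hxt⟩ := exists_neg_symm_add_smul φ hp (hO.mem_nhds hpO) (v, 0)
    refine ⟨x, hxO, hx, by simp [hxt, hp2], fun hxF ↦ hv t ht ?_⟩
    have h1 : (φ x).1 ∈ halfSpace d := ((h.mem_iff x hx).1 hxF).1
    rwa [hxt] at h1

/-- Extendability at one point of a connected part `Z` of `F` propagates to all of `Z`. -/
theorem extendsNear_of_isPreconnected (hcov : MapsSections 1 0 cov) (hF : IsClosed F)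
    (hFs : IsSubmanifoldWithBoundary n 1 F) (hcodim : 1 ≤ codim n 1 F)
    (hσ : IsParallelOn cov σ Fᶜ) {Z : Set M} (hZ : IsPreconnected Z) (hZF : Z ⊆ F) {q : M}
    (hqZ : q ∈ Z) (hq : ExtendsNear cov F σ q) {x : M} (hx : x ∈ Z) : ExtendsNear cov F σ x := by
  have key : ∀ y ∈ F, ∃ O : Set M, IsOpen O ∧ y ∈ O ∧ ∀ z ∈ O, z ∈ F →
      ExtendsNear cov F σ z → ExtendsNear cov F σ y := by
    intro y hy
    obtain ⟨c, hc⟩ := hFs y hy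
    obtain ⟨d, φ, hys, hφ⟩ := hasCodimAt_iff_exists_isSliceChart.1 hc
    obtain ⟨O, hO, hyO, hext⟩ := hφ.exists_extendsNear_of_extendsNear
      (one_le_codim_iff.1 hcodim y hy c hc) hcov hF hσ hys
    refine ⟨O ∩ φ.source, hO.inter φ.open_source, ⟨hyO, hys⟩, fun z hz hzF ↦
      hext z hz.1 hz.2 ?_⟩
    have h1 : (φ z).2 = 0 := ((hφ.mem_iff z hz.2).1 hzF).2
    simp [h1]
  by_contra hxn
  let A : Set M := {y | ExtendsNear cov F σ y}
  let B : Set M := {y | ∃ O : Set M, IsOpen O ∧ y ∈ O ∧ ∀ z ∈ O, z ∈ F → ¬ ExtendsNear cov F σ z}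
  have hA : IsOpen A := isOpen_iff_mem_nhds.2 fun y ⟨N, hN, hyN, h⟩ ↦
    mem_of_superset (hN.mem_nhds hyN) fun z hz ↦ ⟨N, hN, hz, h⟩
  have hB : IsOpen B := isOpen_iff_mem_nhds.2 fun y ⟨O, hO, hyO, h⟩ ↦
    mem_of_superset (hO.mem_nhds hyO) fun z hz ↦ ⟨O, hO, hz, h⟩
  have hmem : ∀ y ∈ F, ¬ ExtendsNear cov F σ y → y ∈ B := fun y hy hyn ↦ by
    obtain ⟨O, hO, hyO, h⟩ := key y hy
    exact ⟨O, hO, hyO, fun z hz hzF hze ↦ hyn (h z hz hzF hze)⟩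
  obtain ⟨z, hz, hzA, O, -, hzO, hzB⟩ := hZ A B hA hB
    (fun y hy ↦ (em (ExtendsNear cov F σ y)).imp id (hmem y (hZF hy)))
    ⟨q, hqZ, hq⟩ ⟨x, hx, hmem x (hZF hx) hxn⟩
  exact hzB z hzO (hZF hz) hzA

/-- A submanifold of positive codimension whose components of codimension `1` all have boundary is
negligible for all `C^1` bundles with connections that take `C^1` sections to continuous ones. -/
theorem negligibleFor_of_codim (hcov : MapsSections 1 0 cov) (hF : IsClosed F)
    (hFs : IsSubmanifoldWithBoundary n 1 F) (hcodim : 1 ≤ codim n 1 F)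
    (hcomp : ¬ ∃ p ∈ F, codim n 1 (connectedComponentIn F p) = 1 ∧
      boundaryPoints (connectedComponentIn F p) = ∅) : NegligibleFor F cov := by
  intro σ hσ
  refine exists_isParallelOn_of_extendsNear (dense_compl_of_one_le_codim hFs hcodim) fun p ↦ ?_
  by_cases hp : p ∉ F
  · exact extendsNear_of_notMem hF hσ hp
  rw [not_not] at hp
  set Z := connectedComponentIn F p with hZ
  have hpZ : p ∈ Z := mem_connectedComponentIn hp
  have hZF : Z ⊆ F := connectedComponentIn_subset F p
  suffices h : ∃ q ∈ Z, ExtendsNear cov F σ q by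
    obtain ⟨q, hqZ, hq⟩ := h
    exact extendsNear_of_isPreconnected hcov hF hFs hcodim hσ isPreconnected_connectedComponentIn
      hZF hqZ hq hpZ
  by_cases hZ1 : codim n 1 Z = 1
  · obtain ⟨q, hq⟩ : (boundaryPoints Z).Nonempty :=
      nonempty_iff_ne_empty.2 fun hb ↦ hcomp ⟨p, hp, hZ1, hb⟩
    refine ⟨q, q.2, ?_⟩
    obtain ⟨c, hc⟩ := hFs q (hZF q.2)
    have hc1 := one_le_codim_iff.1 hcodim q (hZF q.2) c hc
    obtain ⟨d, φ, hqs, hφ⟩ := hasCodimAt_iff_exists_isSliceChart.1 hc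
    refine hφ.extendsNear hc1 hcov hF hσ hqs (hZF q.2) (Or.inr fun hint ↦ ?_)
    obtain ⟨O, hO, hqO, hOF⟩ := hφ.exists_isOpen_connectedComponentIn hqs q.2
    refine notMem_boundaryPoints_of_slice (φ.restrOpen O hO) (hφ.restrOpen hO hOF).mem_iff
      ?_ hint hq
    rw [φ.restrOpen_source]
    exact ⟨hqs, hqO⟩
  · obtain ⟨c, hc⟩ := hFs p hp
    have hc1 := one_le_codim_iff.1 hcodim p hp c hc
    obtain ⟨d, φ, hps, hφ⟩ := hasCodimAt_iff_exists_isSliceChart.1 hc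
    refine ⟨p, hpZ, hφ.extendsNear hc1 hcov hF hσ hps hp (Or.inl ?_)⟩
    have hZc : 1 ≤ codim n 1 Z := one_le_codim_of_interior_eq_empty
      (subset_eq_empty (interior_mono hZF)
        (interior_eq_empty_iff_dense_compl.2 (dense_compl_of_one_le_codim hFs hcodim)))
    by_contra hc2
    obtain rfl : c = 1 := by omega
    exact hZ1 (le_antisymm (codim_le hpZ (hasCodimAt_connectedComponentIn hc hpZ)) hZc)

end Sections

end Submanifold

end ParallelExt

/-! ### The equivalences -/

theorem mainTheorem2 {n : ℕ} (hn : 2 ≤ n) (k : ℕ∞) (hk : 1 ≤ k)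
    (M : Type u) [TopologicalSpace M] [ChartedSpace (EuclideanSpace ℝ (Fin n)) M]
    [IsManifold (𝓡 n) 1 M] [IsManifold (𝓡 n) k M] [T2Space M] [ConnectedSpace M]
    (hM : ParallelExt.DissectedByHypersurfaces n M)
    (F : Set M) (hFM : F ≠ univ) (hFc : IsClosed F)
    (hF : ParallelExt.IsSubmanifoldWithBoundary n 1 F) :
    List.TFAE [
      ParallelExt.NegligibleForAll.{u, v} n k 0 F,
      ParallelExt.NegligibleForAll.{u, v} n k (k - 1) F,
      ParallelExt.NegligibleForTrivialLine n k (k - 1) F,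
      IsNowhereDense F ∧ IsConnected Fᶜ,
      1 ≤ ParallelExt.codim n 1 F ∧
        ¬ ∃ p ∈ F, ParallelExt.codim n 1 (connectedComponentIn F p) = 1 ∧
          ParallelExt.boundaryPoints (connectedComponentIn F p) = ∅] := by
  tfae_have 1 → 2 := by
    intro h l hl V _ _ _ E _ _ _ _ _ _ _ _ _ cov hcov
    -- regarded as a `C^1` bundle, `E` has class `l = 1`, for which the connection is of class `C^0`
    have hl1 : 1 ≤ l := le_add_self.trans hcov.2.1
    have : ContMDiffVectorBundle ((1 : ℕ∞) : ℕ∞ω) V E (𝓡 n) :=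
      ContMDiffVectorBundle.of_le (n := l) (by exact_mod_cast hl1)
    exact h 1 hk V E cov ⟨hcov.1, by simp, hcov.1⟩
  tfae_have 2 → 4 := by
    intro h
    -- the trivial line bundle, lifted to the universe of the fibres
    refine ParallelExt.isNowhereDense_and_isConnected_compl (W := ULift.{v} ℝ) hn hk
      (w := ULift.up 1) (fun h0 ↦ one_ne_zero (congrArg ULift.down h0)) hFc hFM fun cov hcov ↦ ?_
    exact h k le_rfl _ _ cov hcov
  tfae_have 3 → 4 := by
    intro h
    exact ParallelExt.isNowhereDense_and_isConnected_compl hn hk (one_ne_zero (α := ℝ)) hFc hFM h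
  tfae_have 4 → 5 := by
    rintro ⟨hnd, hconn⟩
    have hint := hFc.isNowhereDense_iff.1 hnd
    refine ⟨ParallelExt.one_le_codim_of_interior_eq_empty hint, ?_⟩
    rintro ⟨p, hp, hcodim, hb⟩
    exact ParallelExt.boundaryPoints_nonempty_of_isConnected_compl hM hFc hF
      (interior_eq_empty_iff_dense_compl.1 hint) hconn.isPreconnected hp hcodim hb
  tfae_have 5 → 1 := by
    rintro ⟨h1, h2⟩ l hl V _ _ _ E _ _ _ _ _ _ _ _ _ cov hcov
    have hl1 : 1 ≤ l := by simpa using hcov.2.1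
    have : ContMDiffVectorBundle 1 V E (𝓡 n) :=
      ContMDiffVectorBundle.of_le (n := l) (by exact_mod_cast hl1)
    exact ParallelExt.negligibleFor_of_codim hcov.1 hFc hF h1 h2
  tfae_have 5 → 3 := fun h cov hcov ↦
    ParallelExt.negligibleFor_of_codim hcov.1 hFc hF h.1 h.2
  tfae_finish
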